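/- Let $n \ge 2$, and let $G_1=(V,E_1)$ and $G_2=(V,E_2)$ be two outerplanar graphs on a common set $V$ of $n$ vertices, that is, (finite simple) graphs each of which has a planar drawing in which every vertex lies on the boundary of the outer face. Then $G_1$ and $G_2$ admit a RAC simultaneous drawing with at most three bends per edge on an integer grid of size $(7n-10)\times(7n-10)$. In detail: one can map the vertices of $V$ to points of the plane and draw every edge of $E_1$ and every edge of $E_2$ as a polyline with at most three bends that connects its two end vertices, such that (i) each of the two graphs is drawn planar; (ii) no edge of $E_1$ overlaps an edge of $E_2$ (they share no nondegenerate segment; in particular, an edge that belongs to both graphs is drawn twice); (iii) whenever an edge of $E_1$ and an edge of $E_2$ meet at a point that is not a vertex, they cross there at a right angle; and (iv) all vertices and all bends have integer coordinates in $\{0,1,\dots,7n-11\}$, so that the drawing uses at most $7n-10$ columns and $7n-10$ rows. -/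

import Mathlib

namespace RacSim

/-- The Euclidean plane. -/
abbrev Plane : Type := EuclideanSpace ℝ (Fin 2)

/-- A polyline with `bends` bends, given by its successive corners
`pt 0, pt 1, …, pt (bends + 1)`; the first and the last are its ends, the others its bends. -/
structure Polyline where
  bends : ℕ
  pt : Fin (bends + 2) → Plane

namespace Polyline

/-- The first end of the polyline. -/
def source (P : Polyline) : Plane := P.pt 0

/-- The last end of the polyline. -/
def target (P : Polyline) : Plane := P.pt (Fin.last (P.bends + 1))

/-- The `i`-th (closed) segment of the polyline. -/
def seg (P : Polyline) (i : Fin (P.bends + 1)) : Set Plane :=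
  segment ℝ (P.pt i.castSucc) (P.pt i.succ)

/-- The direction vector of the `i`-th segment. -/
def dir (P : Polyline) (i : Fin (P.bends + 1)) : Plane :=
  P.pt i.succ - P.pt i.castSucc

/-- The set of points of the polyline. -/
def carrier (P : Polyline) : Set Plane := ⋃ i, P.seg i

/-- The polyline is a polygonal arc: its segments are nondegenerate, and two of them meet only
if they are consecutive, and then only in their common corner. -/
def IsSimple (P : Polyline) : Prop :=
  (∀ i : Fin (P.bends + 1), P.pt i.castSucc ≠ P.pt i.succ) ∧
  ∀ i j : Fin (P.bends + 1), i < j → ∀ z ∈ P.seg i ∩ P.seg j,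
    (i : ℕ) + 1 = j ∧ z = P.pt j.castSucc

end Polyline

/-- A drawing of the graph `G` with vertices at the points `p v`: every edge `uv` is drawn as a
polyline whose two ends are `p u` and `p v`. -/
structure PolylineDrawing {V : Type*} (G : SimpleGraph V) (p : V → Plane) where
  edge : G.edgeSet → Polyline
  ends : ∀ e : G.edgeSet, s((edge e).source, (edge e).target) = (e : Sym2 V).map p

namespace PolylineDrawing

variable {V : Type*} {G : SimpleGraph V} {p : V → Plane}

/-- The drawing is planar: distinct vertices are distinct points, every edge is a polygonal arc,
an edge contains no vertices other than its two end vertices, and two distinct edges meet only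
in common end vertices. -/
structure IsPlanar (D : PolylineDrawing G p) : Prop where
  injective : Function.Injective p
  simple : ∀ e, (D.edge e).IsSimple
  vertex : ∀ (e : G.edgeSet) (w : V), p w ∈ (D.edge e).carrier → w ∈ (e : Sym2 V)
  disjoint : ∀ e f : G.edgeSet, e ≠ f →
    ∀ z ∈ (D.edge e).carrier ∩ (D.edge f).carrier,
      ∃ w : V, w ∈ (e : Sym2 V) ∧ w ∈ (f : Sym2 V) ∧ z = p w

/-- The set of all points of the plane that are covered by the drawing. -/
def support (D : PolylineDrawing G p) : Set Plane :=
  Set.range p ∪ ⋃ e, (D.edge e).carrier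

/-- The outer face: the points off the drawing whose connected component in the complement of
the drawing is unbounded (for a drawing of a finite graph there is exactly one such
component). -/
def outerFace (D : PolylineDrawing G p) : Set Plane :=
  {z | z ∈ D.supportᶜ ∧ ¬ Bornology.IsBounded (connectedComponentIn D.supportᶜ z)}

/-- All vertices and all bends are points of the integer grid with columns `0, …, a - 1` and
rows `0, …, b - 1`. -/
def OnGrid (D : PolylineDrawing G p) (a b : ℤ) : Prop :=
  let grid : Set Plane :=
    {z | ∃ x y : ℤ, 0 ≤ x ∧ x < a ∧ 0 ≤ y ∧ y < b ∧ z = !₂[(x : ℝ), (y : ℝ)]}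
  (∀ v, p v ∈ grid) ∧ ∀ e i, (D.edge e).pt i ∈ grid

end PolylineDrawing

/-- A graph is outerplanar if it has a planar drawing (with edges drawn as polygonal arcs) in
which every vertex lies on the boundary of the outer face. -/
def IsOuterplanar {V : Type*} (G : SimpleGraph V) : Prop :=
  ∃ (p : V → Plane) (D : PolylineDrawing G p), D.IsPlanar ∧ ∀ v, p v ∈ frontier D.outerFace

/-- Two drawings with the same vertex positions form a RAC simultaneous drawing: each of them is
planar, no segment of an edge of the first graph overlaps a segment of an edge of the second
(two segments overlap if they share more than one point), and wherever two such segments meet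
outside the vertices, they are perpendicular. -/
structure IsRacSim {V : Type*} {G₁ G₂ : SimpleGraph V} {p : V → Plane}
    (D₁ : PolylineDrawing G₁ p) (D₂ : PolylineDrawing G₂ p) : Prop where
  planar₁ : D₁.IsPlanar
  planar₂ : D₂.IsPlanar
  no_overlap : ∀ e f i j, ((D₁.edge e).seg i ∩ (D₂.edge f).seg j).Subsingleton
  right_angle : ∀ e f i j, ∀ z ∈ (D₁.edge e).seg i ∩ (D₂.edge f).seg j,
    z ∉ Set.range p → inner ℝ ((D₁.edge e).dir i) ((D₂.edge f).dir j) = 0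

end RacSim

/-!
The proof turns two outerplanar drawings into two vertex orders and takes one of them for the
columns and the other one for the rows.

*From drawings to orders.* In an outerplanar drawing no closed walk winds around a vertex that it
misses, because such a vertex can be reached from the outer face. If a vertex `a` had three
neighbours any two of which are joined by a walk that avoids `a` and the third one, there would be
three closed walks through `a`, and comparing the angles under which they are seen from points
close to `a` on the edge that each of them misses gives `π = 0` modulo `2π`
(`PolylineDrawing.angle_relation`, `PolylineDrawing.not_fan`). A graph without such a fan has a
one-page book order (`IsOuterplanar.exists_bookOrder`): at a cut vertex, orders of the parts are
glued; without cut vertices, a longest cycle passes through all vertices, and chords that cross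
with respect to it would yield a fan.

*From an order to a planar drawing.* An edge from `u` to a later vertex `v` is put on the upper
page with tail `u` if `v` is the last neighbour of `u`, and on the lower page with tail `v`
otherwise. Then every vertex is the tail of at most one edge on each page (`IsBook.head_unique`),
which may therefore leave it vertically. It turns into a row above (or below) all vertices, one
that is the farther away the longer the edge is, returns in a column next to its head that is
reserved for it, and ends with a slanted segment of height `1`. On each page two edges are apart
or nested, so the drawing is planar (`bookLayout_isValid`, `Layout.IsValid.drawing_isPlanar`).

*From two orders to a simultaneous drawing.* The second graph is drawn in the same way with the
axes exchanged, so the coordinates of the vertices come from the two orders. Among the vertices,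
the long segments of the first drawing are vertical and those of the second one are horizontal;
the slanted segments stay in the lines reserved for their heads and leave these in different
quadrants, so that all other crossings of the drawings have right angles
(`Layout.IsCompatible.isRacSim`).

*The size of the grid.* A line is needed for every vertex and every slot, and sometimes one more
beside a vertex for the slanted segments of the other drawing. The `n - 1` edges at most on an
upper page and the `n - 2` at most on a lower page give `5 n - 7` lines in each direction when the
second order starts with the last vertex of the first one and does not end with its first vertex,
which turning and reflecting the order achieves. The `2 n - 3` lines outside of these house the
segments far from the vertices. This needs `3 ≤ n`; the sides of a triangle do for `n = 2`.
-/

/-! ### Turning angles of polylines -/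

namespace RacSim

open Filter Topology

/-- The plane, identified with `ℂ`. -/
noncomputable def toC : Plane ≃ₗᵢ[ℝ] ℂ := Complex.orthonormalBasisOneI.repr.symm

/-- The angle in `(-π, π]` under which the segment from `A` to `B` is seen from `q`. -/
noncomputable def viewAngle (q A B : Plane) : ℝ :=
  ((toC B - toC q) / (toC A - toC q)).arg

lemma view_mem_slitPlane {q A B : Plane} (h : q ∉ segment ℝ A B) :
    (toC B - toC q) / (toC A - toC q) ∈ Complex.slitPlane := by
  by_contra hs
  rw [Complex.mem_slitPlane_iff_not_le_zero, not_not] at hs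
  have hA : toC A - toC q ≠ 0 := by
    intro h0
    apply h
    rw [← toC.injective (sub_eq_zero.1 h0)]
    exact left_mem_segment ℝ _ _
  obtain ⟨t, ht0, ht⟩ : ∃ t : ℝ, 0 ≤ t ∧ (toC B - toC q) / (toC A - toC q) = ((-t : ℝ) : ℂ) := by
    rw [Complex.le_def] at hs
    refine ⟨-((toC B - toC q) / (toC A - toC q)).re, by simpa using hs.1, ?_⟩
    apply Complex.ext
    · simp
    · simpa using hs.2
  rw [div_eq_iff hA] at ht
  have h2 : B - q = (-t) • (A - q) := by
    apply toC.injective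
    rw [map_sub, map_smul, map_sub, ht, Complex.real_smul]
  apply h
  have h1t : (1 + t) ≠ 0 := by positivity
  refine ⟨t / (1 + t), 1 / (1 + t), by positivity, by positivity, by field_simp; ring, ?_⟩
  have hB : B = q - t • (A - q) := by
    rw [eq_sub_iff_add_eq, ← sub_eq_zero]
    have := h2
    rw [neg_smul, eq_neg_iff_add_eq_zero] at this
    rw [← this]; abel
  rw [hB]
  ext k
  simp
  field_simp
  ring

lemma sub_toC_ne_zero {q A : Plane} (h : q ≠ A) : toC A - toC q ≠ 0 := by
  rw [sub_ne_zero]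
  exact fun h' => h (toC.injective h'.symm)

lemma ne_left_of_notMem_segment {q A B : Plane} (h : q ∉ segment ℝ A B) : q ≠ A := by
  rintro rfl; exact h (left_mem_segment ℝ _ _)

lemma ne_right_of_notMem_segment {q A B : Plane} (h : q ∉ segment ℝ A B) : q ≠ B := by
  rintro rfl; exact h (right_mem_segment ℝ _ _)

lemma viewAngle_continuousAt {q A B : Plane} (h : q ∉ segment ℝ A B) :
    ContinuousAt (fun q => viewAngle q A B) q := by
  unfold viewAngle
  refine ContinuousAt.comp (g := Complex.arg)
    (Complex.continuousAt_arg (view_mem_slitPlane h)) ?_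
  have hc : Continuous toC := toC.continuous
  exact ContinuousAt.div (by fun_prop) (by fun_prop) (sub_toC_ne_zero (ne_left_of_notMem_segment h))

lemma viewAngle_coe {q A B : Plane} (hA : q ≠ A) (hB : q ≠ B) :
    (viewAngle q A B : Real.Angle) = (toC B - toC q).arg - (toC A - toC q).arg :=
  Complex.arg_div_coe_angle (sub_toC_ne_zero hB) (sub_toC_ne_zero hA)

lemma viewAngle_symm {q A B : Plane} (h : q ∉ segment ℝ A B) :
    viewAngle q B A = -viewAngle q A B := by
  unfold viewAngle
  rw [← inv_div, Complex.arg_inv, if_neg (Complex.mem_slitPlane_iff_arg.1 (view_mem_slitPlane h)).1]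

lemma viewAngle_tendsto_cobounded (A B : Plane) :
    Tendsto (fun q => viewAngle q A B) (Bornology.cobounded Plane) (𝓝 0) := by
  have hco : Tendsto (fun q => toC A - toC q) (Bornology.cobounded Plane)
      (Bornology.cobounded ℂ) := by
    rw [← tendsto_norm_atTop_iff_cobounded]
    have h0 : Tendsto (fun q : Plane => ‖q‖ - ‖A‖) (Bornology.cobounded Plane) atTop :=
      tendsto_atTop_add_const_right _ _ tendsto_norm_cobounded_atTop
    refine tendsto_atTop_mono (fun q => ?_) h0
    rw [← map_sub, toC.norm_map, norm_sub_rev]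
    exact norm_sub_norm_le q A
  have h1 : Tendsto (fun q => 1 + (toC B - toC A) * (toC A - toC q)⁻¹)
      (Bornology.cobounded Plane) (𝓝 1) := by
    have := ((tendsto_inv₀_cobounded (α := ℂ)).comp hco).const_mul (toC B - toC A)
    simpa using this.const_add 1
  have h2 := (Complex.continuousAt_arg Complex.one_mem_slitPlane).tendsto.comp h1
  rw [Complex.arg_one] at h2
  refine h2.congr' ?_
  filter_upwards [Bornology.eventually_ne_cobounded A] with q hq
  have hq' := sub_toC_ne_zero hq
  simp only [Function.comp, viewAngle]
  congr 1
  field_simp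
  ring

lemma Fin.sum_sub_telescope {M : Type*} [AddCommGroup M] {n : ℕ} (g : Fin (n + 1) → M) :
    ∑ i : Fin n, (g i.succ - g i.castSucc) = g (Fin.last n) - g 0 := by
  induction n with
  | zero => simp
  | succ n ih =>
    rw [Fin.sum_univ_castSucc]
    have := ih (fun i => g i.castSucc)
    simp only [Fin.succ_castSucc, Fin.succ_last] at this ⊢
    rw [this]
    simp

namespace Polyline

/-- The total angle under which the polyline, traversed from its source to its target, is seen
from `q`. -/
noncomputable def turning (P : Polyline) (q : Plane) : ℝ :=
  ∑ i : Fin (P.bends + 1), viewAngle q (P.pt i.castSucc) (P.pt i.succ)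

lemma notMem_seg {P : Polyline} {q : Plane} (h : q ∉ P.carrier) (i) : q ∉ P.seg i :=
  fun hi => h (Set.mem_iUnion.2 ⟨i, hi⟩)

lemma turning_continuousAt {P : Polyline} {q : Plane} (h : q ∉ P.carrier) :
    ContinuousAt P.turning q := by
  unfold turning
  exact tendsto_finsetSum _ fun i _ => viewAngle_continuousAt (notMem_seg h i)

lemma turning_coe {P : Polyline} {q : Plane} (h : q ∉ P.carrier) :
    (P.turning q : Real.Angle) =
      (toC P.target - toC q).arg - (toC P.source - toC q).arg := by
  have h1 : (P.turning q : Real.Angle) = ∑ i : Fin (P.bends + 1),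
      (((toC (P.pt i.succ) - toC q).arg : Real.Angle) - (toC (P.pt i.castSucc) - toC q).arg) := by
    unfold turning
    rw [← Real.Angle.coe_coeHom, map_sum Real.Angle.coeHom]
    refine Finset.sum_congr rfl fun i _ => ?_
    rw [Real.Angle.coe_coeHom]
    exact viewAngle_coe (ne_left_of_notMem_segment (notMem_seg h i))
      (ne_right_of_notMem_segment (notMem_seg h i))
  rw [h1, Fin.sum_sub_telescope (fun i => ((toC (P.pt i) - toC q).arg : Real.Angle))]
  rfl

lemma turning_tendsto_cobounded (P : Polyline) :
    Tendsto P.turning (Bornology.cobounded Plane) (𝓝 0) := by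
  have := tendsto_finsetSum (Finset.univ : Finset (Fin (P.bends + 1)))
    fun i _ => viewAngle_tendsto_cobounded (P.pt i.castSucc) (P.pt i.succ)
  rw [Finset.sum_const_zero] at this
  exact this

/-- The polyline traversed backwards. -/
def reverse (P : Polyline) : Polyline := ⟨P.bends, fun i => P.pt i.rev⟩

lemma reverse_source (P : Polyline) : P.reverse.source = P.target :=
  congrArg P.pt (Fin.rev_zero _)

lemma reverse_target (P : Polyline) : P.reverse.target = P.source :=
  congrArg P.pt (Fin.rev_last _)

lemma reverse_seg (P : Polyline) (i : Fin (P.bends + 1)) :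
    P.reverse.seg i = P.seg i.rev := by
  unfold seg reverse
  rw [segment_symm]
  simp [Fin.rev_castSucc, Fin.rev_succ]

lemma reverse_carrier (P : Polyline) : P.reverse.carrier = P.carrier := by
  refine Set.Subset.antisymm ?_ ?_
  · exact Set.iUnion_subset fun i =>
      (P.reverse_seg i).subset.trans (Set.subset_iUnion P.seg (Fin.rev (n := P.bends + 1) i))
  · refine Set.iUnion_subset fun i => ?_
    have := P.reverse_seg i.rev
    rw [Fin.rev_rev] at this
    exact this.symm.subset.trans (Set.subset_iUnion P.reverse.seg (Fin.rev (n := P.bends + 1) i))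

lemma reverse_turning {P : Polyline} {q : Plane} (h : q ∉ P.carrier) :
    P.reverse.turning q = -P.turning q := by
  change ∑ i : Fin (P.bends + 1), viewAngle q (P.pt i.castSucc.rev) (P.pt i.succ.rev) =
    -∑ i : Fin (P.bends + 1), viewAngle q (P.pt i.castSucc) (P.pt i.succ)
  rw [← Finset.sum_neg_distrib]
  refine Fintype.sum_equiv Fin.revPerm _ _ fun i => ?_
  rw [Fin.revPerm_apply, Fin.rev_castSucc, Fin.rev_succ]
  exact viewAngle_symm (notMem_seg h i.rev)

end Polyline
end RacSim

/-! ### The turning of a closed walk of edges around a point -/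

namespace RacSim

open Filter Topology

namespace Polyline

lemma IsSimple.reverse {P : Polyline} (h : P.IsSimple) : P.reverse.IsSimple := by
  constructor
  · intro (i : Fin (P.bends + 1))
    have := h.1 i.rev
    rw [← Fin.rev_castSucc, ← Fin.rev_succ] at this
    exact this.symm
  · intro (i : Fin (P.bends + 1)) (j : Fin (P.bends + 1)) hij z hz
    rw [reverse_seg P i, reverse_seg P j] at hz
    obtain ⟨h1, h2⟩ := h.2 j.rev i.rev (Fin.rev_lt_rev.2 hij) z hz.symm
    have e : i.rev.castSucc = j.castSucc.rev := by
      rw [Fin.rev_castSucc]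
      exact Fin.ext (by rw [Fin.val_castSucc, Fin.val_succ, h1])
    refine ⟨?_, by rw [h2, e]; rfl⟩
    rw [Fin.val_rev, Fin.val_rev] at h1
    have := i.2
    have := j.2
    omega

lemma IsSimple.source_notMem_seg {P : Polyline} (h : P.IsSimple) {i : Fin (P.bends + 1)}
    (hi : i ≠ 0) : P.source ∉ P.seg i := by
  intro hz
  have h0 : P.source ∈ P.seg 0 := by unfold seg source; exact left_mem_segment ℝ _ _
  obtain ⟨h1, h2⟩ := h.2 0 i (Fin.pos_of_ne_zero hi) _ ⟨h0, hz⟩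
  have e : i.castSucc = Fin.succ 0 := Fin.ext (by
    rw [Fin.val_castSucc, Fin.val_succ, ← h1])
  rw [e] at h2
  exact h.1 0 h2

lemma isClosed_carrier (P : Polyline) : IsClosed P.carrier := by
  refine isClosed_iUnion_of_finite fun i => ?_
  unfold seg
  rw [← convexHull_pair]
  exact (Set.Finite.isCompact_convexHull (𝕜 := ℝ) (by simp)).isClosed

end Polyline

namespace PolylineDrawing

variable {V : Type*} {G : SimpleGraph V} {p : V → Plane} (D : PolylineDrawing G p)

open Classical in
/-- The edge `xy`, traversed from `x` to `y`. -/
noncomputable def arc {x y : V} (h : G.Adj x y) : Polyline :=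
  if (D.edge ⟨s(x, y), h⟩).source = p x then D.edge ⟨s(x, y), h⟩
  else (D.edge ⟨s(x, y), h⟩).reverse

lemma arc_carrier {x y : V} (h : G.Adj x y) :
    (D.arc h).carrier = (D.edge ⟨s(x, y), h⟩).carrier := by
  unfold arc
  split_ifs
  · rfl
  · rw [Polyline.reverse_carrier]

lemma arc_source_target {x y : V} (h : G.Adj x y) :
    (D.arc h).source = p x ∧ (D.arc h).target = p y := by
  have h1 := D.ends ⟨s(x, y), h⟩
  simp only [Sym2.map_mk, Sym2.eq_iff] at h1
  unfold arc
  split_ifs with h2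
  · rcases h1 with h1 | h1
    · exact h1
    · exact ⟨h2, by rw [h1.2, ← h2, h1.1]⟩
  · rw [Polyline.reverse_source, Polyline.reverse_target]
    rcases h1 with h1 | h1
    · exact absurd h1.1 h2
    · exact ⟨h1.2, h1.1⟩

lemma arc_isSimple (hD : D.IsPlanar) {x y : V} (h : G.Adj x y) : (D.arc h).IsSimple := by
  unfold arc
  split_ifs
  · exact hD.simple _
  · exact (hD.simple _).reverse

lemma arc_turning_symm (hD : D.IsPlanar) {x y : V} (h : G.Adj x y) {q : Plane}
    (hq : q ∉ (D.arc h).carrier) :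
    (D.arc h.symm).turning q = -(D.arc h).turning q := by
  have e : (⟨s(y, x), h.symm⟩ : G.edgeSet) = ⟨s(x, y), h⟩ := Subtype.ext Sym2.eq_swap
  have hne : p x ≠ p y := fun h' => h.ne (hD.injective h')
  have h1 := D.ends ⟨s(x, y), h⟩
  simp only [Sym2.map_mk, Sym2.eq_iff] at h1
  rw [arc_carrier] at hq
  unfold arc
  rw [e]
  rcases h1 with h1 | h1
  · rw [if_neg (by rw [h1.1]; exact hne), if_pos h1.1]
    exact Polyline.reverse_turning hq
  · rw [if_pos h1.1, if_neg (by rw [h1.1]; exact hne.symm), Polyline.reverse_turning hq, neg_neg]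

/-- The points covered by the edges of a walk. -/
def trace {x y : V} (w : G.Walk x y) : Set Plane :=
  {z | ∃ e : G.edgeSet, (e : Sym2 V) ∈ w.edges ∧ z ∈ (D.edge e).carrier}

lemma trace_cons {x y z : V} (h : G.Adj x y) (w : G.Walk y z) :
    D.trace (.cons h w) = (D.arc h).carrier ∪ D.trace w := by
  ext q
  simp only [trace, SimpleGraph.Walk.edges_cons, List.mem_cons, Set.mem_ofPred_eq, Set.mem_union,
    arc_carrier]
  constructor
  · rintro ⟨⟨e, he'⟩, he | he, hq⟩
    · obtain rfl : e = s(x, y) := he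
      exact Or.inl hq
    · exact Or.inr ⟨⟨e, he'⟩, he, hq⟩
  · rintro (hq | ⟨e, he, hq⟩)
    · exact ⟨_, Or.inl rfl, hq⟩
    · exact ⟨e, Or.inr he, hq⟩

lemma trace_append {x y z : V} (w : G.Walk x y) (w' : G.Walk y z) :
    D.trace (w.append w') = D.trace w ∪ D.trace w' := by
  ext q
  simp only [trace, SimpleGraph.Walk.edges_append, List.mem_append, Set.mem_ofPred_eq,
    Set.mem_union]
  constructor
  · rintro ⟨e, he | he, hq⟩
    · exact Or.inl ⟨e, he, hq⟩
    · exact Or.inr ⟨e, he, hq⟩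
  · rintro (⟨e, he, hq⟩ | ⟨e, he, hq⟩)
    · exact ⟨e, Or.inl he, hq⟩
    · exact ⟨e, Or.inr he, hq⟩

lemma trace_subset_support {x y : V} (w : G.Walk x y) : D.trace w ⊆ D.support := by
  rintro z ⟨e, -, hz⟩
  exact Or.inr (Set.mem_iUnion.2 ⟨e, hz⟩)

lemma isClosed_trace {x y : V} (w : G.Walk x y) : IsClosed (D.trace w) := by
  induction w with
  | nil => simp [trace]
  | cons h w ih => rw [trace_cons]; exact (Polyline.isClosed_carrier _).union ih

/-- A vertex that a walk does not visit is off its trace. -/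
lemma vertex_notMem_trace (hD : D.IsPlanar) {x y v : V} {w : G.Walk x y} (h : v ∉ w.support) :
    p v ∉ D.trace w := by
  rintro ⟨e, he, hz⟩
  exact h (SimpleGraph.Walk.mem_support_of_mem_edges he (hD.vertex e v hz))

/-- The total angle under which a walk is seen from `q`. -/
noncomputable def winding : ∀ {x y : V}, G.Walk x y → Plane → ℝ
  | _, _, .nil, _ => 0
  | _, _, .cons h w, q => (D.arc h).turning q + winding w q

lemma winding_append {x y z : V} (w : G.Walk x y) (w' : G.Walk y z) (q : Plane) :
    D.winding (w.append w') q = D.winding w q + D.winding w' q := by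
  induction w with
  | nil => simp [winding]
  | cons h w ih => simp [winding, ih, add_assoc]

lemma winding_continuousAt {x y : V} (w : G.Walk x y) {q : Plane} (hq : q ∉ D.trace w) :
    ContinuousAt (D.winding w) q := by
  induction w with
  | nil => exact continuousAt_const
  | cons h w ih =>
    rw [trace_cons, Set.mem_union, not_or] at hq
    exact (Polyline.turning_continuousAt hq.1).add (ih hq.2)

lemma winding_tendsto_cobounded {x y : V} (w : G.Walk x y) :
    Tendsto (D.winding w) (Bornology.cobounded Plane) (𝓝 0) := by
  induction w with
  | nil => exact tendsto_const_nhds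
  | cons h w ih =>
    have := (Polyline.turning_tendsto_cobounded (D.arc h)).add ih
    rwa [add_zero] at this

lemma winding_coe {x y : V} (w : G.Walk x y) {q : Plane} (hq : q ∉ D.trace w) :
    (D.winding w q : Real.Angle) = (toC (p y) - toC q).arg - (toC (p x) - toC q).arg := by
  induction w with
  | nil => simp [winding]
  | cons h w ih =>
    rw [trace_cons, Set.mem_union, not_or] at hq
    rw [winding, Real.Angle.coe_add, Polyline.turning_coe hq.1, ih hq.2,
      (D.arc_source_target h).1, (D.arc_source_target h).2]
    abel

lemma winding_eq_int_mul {x : V} (w : G.Walk x x) {q : Plane} (hq : q ∉ D.trace w) :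
    ∃ k : ℤ, D.winding w q = 2 * Real.pi * k := by
  have h := D.winding_coe w hq
  rw [sub_self, ← Real.Angle.coe_zero, Real.Angle.angle_eq_iff_two_pi_dvd_sub] at h
  simpa using h

lemma winding_eq_of_isPreconnected {x : V} (w : G.Walk x x) {U : Set Plane}
    (hU : IsPreconnected U) (hd : ∀ q ∈ U, q ∉ D.trace w) {q q' : Plane} (hq : q ∈ U)
    (hq' : q' ∈ U) : D.winding w q = D.winding w q' := by
  have hpi : (2 * Real.pi) ≠ 0 := by positivity
  have hc : ContinuousOn (fun q => D.winding w q / (2 * Real.pi)) U := fun q hq =>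
    ((D.winding_continuousAt w (hd q hq)).div_const _).continuousWithinAt
  have hm : Set.MapsTo (fun q => D.winding w q / (2 * Real.pi)) U
      (Set.range ((↑) : ℤ → ℝ)) := by
    intro q hq
    obtain ⟨k, hk⟩ := D.winding_eq_int_mul w (hd q hq)
    exact ⟨k, by simp only [hk]; field_simp⟩
  have hdisc : IsDiscrete (Set.range ((↑) : ℤ → ℝ)) := by
    rw [← Set.image_univ]
    exact IsDiscrete.univ.image Int.isClosedEmbedding_coe_real.isInducing
  have := hU.constant_of_mapsTo hdisc hc hm hq hq'
  field_simp at this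
  exact this

lemma winding_eq_zero_of_outerFace {x : V} (w : G.Walk x x) {q : Plane} (hq : q ∈ D.outerFace) :
    D.winding w q = 0 := by
  obtain ⟨hq, hu⟩ := hq
  have hev := (D.winding_tendsto_cobounded w).eventually (Metric.ball_mem_nhds 0 Real.two_pi_pos)
  rw [Filter.Eventually, ← Bornology.isCobounded_def, ← Bornology.isBounded_compl_iff] at hev
  obtain ⟨q', hq', hn⟩ : ∃ q' ∈ connectedComponentIn D.supportᶜ q,
      D.winding w q' ∈ Metric.ball 0 (2 * Real.pi) := by
    by_contra hcon
    push Not at hcon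
    exact hu (hev.subset hcon)
  have hd : ∀ z ∈ connectedComponentIn D.supportᶜ q, z ∉ D.trace w := fun z hz hz' =>
    connectedComponentIn_subset _ _ hz (D.trace_subset_support w hz')
  rw [D.winding_eq_of_isPreconnected w isPreconnected_connectedComponentIn hd
    (mem_connectedComponentIn hq) hq']
  obtain ⟨k, hk⟩ := D.winding_eq_int_mul w (hd q' hq')
  rw [hk] at hn ⊢
  rw [mem_ball_zero_iff, Real.norm_eq_abs, abs_mul, abs_of_pos Real.two_pi_pos] at hn
  have hk1 : |(k : ℝ)| < 1 := by
    have := Real.two_pi_pos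
    nlinarith
  have hk0 : k = 0 := by
    rw [← Int.abs_lt_one_iff]
    exact_mod_cast hk1
  simp [hk0]

/-- A closed walk does not wind around a point of the closure of the outer face. -/
lemma winding_eq_zero_of_frontier {x : V} (w : G.Walk x x) {q : Plane}
    (hq : q ∈ frontier D.outerFace) (hw : q ∉ D.trace w) : D.winding w q = 0 := by
  obtain ⟨r, hr, hb⟩ := Metric.isOpen_iff.1 (D.isClosed_trace w).isOpen_compl q hw
  obtain ⟨q', hq', hqq⟩ := Metric.mem_closure_iff.1 (frontier_subset_closure hq) r hr
  rw [D.winding_eq_of_isPreconnected w (convex_ball q r).isPreconnected (fun z hz => hb hz)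
    (Metric.mem_ball_self hr) (Metric.mem_ball'.2 hqq)]
  exact D.winding_eq_zero_of_outerFace w hq'

end PolylineDrawing
end RacSim

/-! ### Three mutually joined neighbours in an outerplanar drawing -/

namespace RacSim

open Filter Topology

namespace Polyline

/-- The direction in which the polyline leaves its source, as a complex number. -/
noncomputable def initialDir (P : Polyline) : ℂ := toC (P.dir 0)

/-- The contribution of all segments but the first one to the turning of the polyline around its
source. -/
noncomputable def restTurning (P : Polyline) : ℝ :=
  ∑ i : Fin P.bends, viewAngle P.source (P.pt i.succ.castSucc) (P.pt i.succ.succ)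

lemma IsSimple.initialDir_ne_zero {P : Polyline} (h : P.IsSimple) : P.initialDir ≠ 0 := by
  unfold initialDir dir
  rw [Ne, map_eq_zero_iff _ toC.injective, sub_eq_zero]
  exact (h.1 0).symm

lemma source_add_smul_mem {P : Polyline} {r : ℝ} (h0 : 0 ≤ r) (h1 : r ≤ 1) :
    P.source + r • P.dir 0 ∈ P.seg 0 := by
  unfold seg
  rw [segment_eq_image']
  exact ⟨r, ⟨h0, h1⟩, rfl⟩

/-- As `q` approaches the source of a polygonal arc along a direction `d` other than its initial
one, the angle under which the first segment is seen tends to the angle from `-d` to the initial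
direction. -/
lemma IsSimple.turning_tendsto {P : Polyline} (h : P.IsSimple) {d : Plane}
    (hd : -(P.initialDir / toC d) ∈ Complex.slitPlane) :
    Tendsto (fun r : ℝ => P.turning (P.source + r • d)) (𝓝[>] 0)
      (𝓝 ((-(P.initialDir / toC d)).arg + P.restTurning)) := by
  have hd0 : toC d ≠ 0 := by
    intro h0
    rw [h0, div_zero, neg_zero] at hd
    exact Complex.slitPlane_ne_zero hd rfl
  have hq : Tendsto (fun r : ℝ => P.source + r • d) (𝓝[>] 0) (𝓝 P.source) := by
    have : Continuous fun r : ℝ => P.source + r • d := by fun_prop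
    have := this.tendsto 0
    rw [zero_smul, add_zero] at this
    exact this.mono_left nhdsWithin_le_nhds
  have hrest : Tendsto (fun r : ℝ => ∑ i : Fin P.bends,
      viewAngle (P.source + r • d) (P.pt i.succ.castSucc) (P.pt i.succ.succ)) (𝓝[>] 0)
      (𝓝 P.restTurning) := by
    refine tendsto_finsetSum _ fun i _ => ?_
    exact (viewAngle_continuousAt (h.source_notMem_seg (Fin.succ_ne_zero i))).tendsto.comp hq
  have hfirst : Tendsto (fun r : ℝ => viewAngle (P.source + r • d) (P.pt 0) (P.pt 1)) (𝓝[>] 0)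
      (𝓝 (-(P.initialDir / toC d)).arg) := by
    have h1 : Tendsto (fun r : ℝ => (-((P.initialDir - r * toC d) / toC d)).arg) (𝓝[>] 0)
        (𝓝 (-(P.initialDir / toC d)).arg) := by
      refine (Complex.continuousAt_arg hd).tendsto.comp ?_
      have hc : Continuous fun r : ℝ => -((P.initialDir - r * toC d) / toC d) := by fun_prop
      have := hc.tendsto 0
      simp only [Complex.ofReal_zero, zero_mul, sub_zero] at this
      exact this.mono_left nhdsWithin_le_nhds
    refine h1.congr' ?_
    filter_upwards [self_mem_nhdsWithin] with r hr
    have hr0 : (r : ℂ) ≠ 0 := by exact_mod_cast (ne_of_gt hr)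
    unfold viewAngle
    have e : (toC (P.pt 1) - toC (P.source + r • d)) / (toC (P.pt 0) - toC (P.source + r • d)) =
        ((r⁻¹ : ℝ) : ℂ) * (-((P.initialDir - r * toC d) / toC d)) := by
      simp only [map_add, map_smul, initialDir, dir, map_sub, source, Complex.real_smul]
      simp only [Fin.castSucc_zero, Fin.succ_zero_eq_one]
      push_cast
      have : toC (P.pt 0) - (toC (P.pt 0) + r * toC d) = -(r * toC d) := by ring
      rw [this]
      field_simp
      ring
    rw [e, Complex.arg_real_mul _ (inv_pos.2 hr)]
  refine (hfirst.add hrest).congr fun r => ?_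
  unfold turning
  rw [Fin.sum_univ_succ]
  rfl

end Polyline

namespace PolylineDrawing

variable {V : Type*} {G : SimpleGraph V} {p : V → Plane} (D : PolylineDrawing G p)

/-- Two edges leave a common end vertex in different directions. -/
lemma neg_div_initialDir_mem_slitPlane (hD : D.IsPlanar) {a b c : V} (hb : G.Adj a b)
    (hc : G.Adj a c) (hbc : b ≠ c) :
    -((D.arc hb).initialDir / (D.arc hc).initialDir) ∈ Complex.slitPlane := by
  have hb0 := (D.arc_isSimple hD hb).initialDir_ne_zero
  have hc0 := (D.arc_isSimple hD hc).initialDir_ne_zero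
  by_contra hs
  rw [Complex.mem_slitPlane_iff_not_le_zero, not_not, Complex.le_def] at hs
  obtain ⟨t, ht0, ht⟩ : ∃ t : ℝ, 0 ≤ t ∧
      (D.arc hb).initialDir / (D.arc hc).initialDir = (t : ℂ) := by
    refine ⟨((D.arc hb).initialDir / (D.arc hc).initialDir).re, by simpa using hs.1, ?_⟩
    apply Complex.ext
    · simp
    · simpa using hs.2
  rw [div_eq_iff hc0] at ht
  have htpos : 0 < t := by
    rcases ht0.lt_or_eq with h | h
    · exact h
    · rw [← h, Complex.ofReal_zero, zero_mul] at ht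
      exact absurd ht hb0
  have hdir : (D.arc hb).dir 0 = t • (D.arc hc).dir 0 := by
    apply toC.injective
    rw [map_smul, Complex.real_smul]
    exact ht
  set r := min 1 t with hr
  have hr0 : 0 < r := lt_min one_pos htpos
  have hzc : p a + r • (D.arc hc).dir 0 ∈ (D.arc hc).carrier := by
    rw [← (D.arc_source_target hc).1]
    exact Set.mem_iUnion.2 ⟨0, Polyline.source_add_smul_mem hr0.le (min_le_left _ _)⟩
  have hzb : p a + r • (D.arc hc).dir 0 ∈ (D.arc hb).carrier := by
    have e : r • (D.arc hc).dir 0 = (r / t) • (D.arc hb).dir 0 := by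
      rw [hdir, smul_smul, div_mul_cancel₀ _ htpos.ne']
    rw [e, ← (D.arc_source_target hb).1]
    exact Set.mem_iUnion.2 ⟨0, Polyline.source_add_smul_mem (by positivity)
      ((div_le_one htpos).2 (min_le_right _ _))⟩
  rw [arc_carrier] at hzb hzc
  obtain ⟨w, hw1, hw2, hw⟩ := hD.disjoint ⟨s(a, b), hb⟩ ⟨s(a, c), hc⟩ (by
    intro h
    rcases Sym2.eq_iff.1 (congrArg Subtype.val h) with h | h
    · exact hbc h.2
    · exact hb.ne h.2.symm) _ ⟨hzb, hzc⟩
  have hwa : w = a := by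
    simp only [Sym2.mem_iff] at hw1 hw2
    rcases hw1 with h | h
    · exact h
    · rcases hw2 with h' | h'
      · exact h'
      · exact absurd (h.symm.trans h') hbc
  rw [hwa, add_eq_left, smul_eq_zero] at hw
  rcases hw with hw | hw
  · exact hr0.ne' hw
  · exact hc0 (by unfold Polyline.initialDir; rw [hw, map_zero])

/-- A closed walk that misses the vertex `b` does not wind around any point of an edge `ab` but
`a`. -/
lemma winding_eq_zero_of_edge (hD : D.IsPlanar) (hout : ∀ v, p v ∈ frontier D.outerFace)
    {a b x : V} (h : G.Adj a b) (C : G.Walk x x) (hb : b ∉ C.support) :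
    ∀ r : ℝ, 0 < r → r ≤ 1 → p a + r • (D.arc h).dir 0 ∉ D.trace C ∧
      D.winding C (p a + r • (D.arc h).dir 0) = 0 := by
  have hsimple := D.arc_isSimple hD h
  have hst := D.arc_source_target h
  set P := D.arc h with hP
  have hoff : ∀ z ∈ P.carrier, z ≠ p a → z ∉ D.trace C := by
    rintro z hz hza ⟨e, he, hze⟩
    rw [hP, arc_carrier] at hz
    obtain ⟨w, hw1, hw2, hw⟩ := hD.disjoint e ⟨s(a, b), h⟩ (by
      rintro rfl
      exact hb (SimpleGraph.Walk.snd_mem_support_of_mem_edges _ he)) z ⟨hze, hz⟩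
    simp only [Sym2.mem_iff] at hw2
    rcases hw2 with rfl | rfl
    · exact hza hw
    · exact hb (SimpleGraph.Walk.mem_support_of_mem_edges he hw1)
  have hcorner : ∀ i : Fin (P.bends + 2), i ≠ 0 → D.winding C (P.pt i) = 0 := by
    intro i
    induction i using Fin.reverseInduction with
    | last =>
      intro _
      have e : P.pt (Fin.last (P.bends + 1)) = p b := hst.2
      rw [e]
      exact D.winding_eq_zero_of_frontier C (hout b) (D.vertex_notMem_trace hD hb)
    | cast i ih =>
      intro hi
      have hi0 : i ≠ 0 := fun h0 => hi (by rw [h0, Fin.castSucc_zero])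
      rw [← ih (Fin.succ_ne_zero i)]
      refine D.winding_eq_of_isPreconnected C (U := P.seg i) (convex_segment _ _).isPreconnected
        (fun z hz => hoff z (Set.mem_iUnion.2 ⟨i, hz⟩) ?_) (left_mem_segment ℝ _ _)
        (right_mem_segment ℝ _ _)
      rintro rfl
      rw [← hst.1] at hz
      exact hsimple.source_notMem_seg hi0 hz
  have hd0 : P.dir 0 ≠ 0 := by
    intro h0
    exact hsimple.initialDir_ne_zero (by unfold Polyline.initialDir; rw [h0, map_zero])
  have hfirst : ∀ r : ℝ, 0 < r → r ≤ 1 → p a + r • P.dir 0 ∉ D.trace C := by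
    intro r hr hr1
    refine hoff _ ?_ ?_
    · rw [← hst.1]
      exact Set.mem_iUnion.2 ⟨0, Polyline.source_add_smul_mem hr.le hr1⟩
    · rw [Ne, add_eq_left, smul_eq_zero]
      exact fun h' => h'.elim hr.ne' hd0
  intro r hr hr1
  refine ⟨hfirst r hr hr1, ?_⟩
  have h1 : p a + (1 : ℝ) • P.dir 0 = P.pt 1 := by
    rw [← hst.1, one_smul]
    unfold Polyline.source Polyline.dir
    rw [Fin.castSucc_zero, Fin.succ_zero_eq_one, add_sub_cancel]
  rw [← hcorner 1 (by simp), ← h1]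
  refine D.winding_eq_of_isPreconnected C (U := (fun s : ℝ => p a + s • P.dir 0) '' Set.Icc r 1)
    (isPreconnected_Icc.image _ (by fun_prop)) ?_ ⟨r, ⟨le_rfl, hr1⟩, rfl⟩ ⟨1, ⟨hr1, le_rfl⟩, rfl⟩
  rintro _ ⟨s, hs, rfl⟩
  exact hfirst s (hr.trans_le hs.1) hs.2

/-- The winding number of the closed walk `a b₁ ⋯ b₂ a` vanishes near `a` on the edge `a b₃`;
this is the limit of that equation at `a`. -/
lemma angle_relation (hD : D.IsPlanar) (hout : ∀ v, p v ∈ frontier D.outerFace)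
    {a b₁ b₂ b₃ : V} (h₁ : G.Adj a b₁) (h₂ : G.Adj a b₂) (h₃ : G.Adj a b₃) (w : G.Walk b₁ b₂)
    (ha : a ∉ w.support) (hb : b₃ ∉ w.support) :
    (-((D.arc h₁).initialDir / (D.arc h₃).initialDir)).arg + (D.arc h₁).restTurning
      + D.winding w (p a)
      - ((-((D.arc h₂).initialDir / (D.arc h₃).initialDir)).arg + (D.arc h₂).restTurning) = 0 := by
  have h13 : b₁ ≠ b₃ := by rintro rfl; exact hb w.start_mem_support
  have h23 : b₂ ≠ b₃ := by rintro rfl; exact hb w.end_mem_support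
  set C : G.Walk a a := .cons h₁ (w.append (.cons h₂.symm .nil)) with hC
  have hbC : b₃ ∉ C.support := by
    simp only [hC, SimpleGraph.Walk.support_cons, SimpleGraph.Walk.support_append,
      SimpleGraph.Walk.support_nil, List.tail_cons, List.mem_cons, List.mem_append,
      List.not_mem_nil, or_false, not_or]
    exact ⟨h₃.ne', hb, h₃.ne'⟩
  have hz := D.winding_eq_zero_of_edge hD hout h₃ C hbC
  have hs1 := (D.arc_source_target h₁).1
  have hs2 := (D.arc_source_target h₂).1
  have t1 := (D.arc_isSimple hD h₁).turning_tendsto (d := (D.arc h₃).dir 0)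
    (D.neg_div_initialDir_mem_slitPlane hD h₁ h₃ h13)
  have t2 := (D.arc_isSimple hD h₂).turning_tendsto (d := (D.arc h₃).dir 0)
    (D.neg_div_initialDir_mem_slitPlane hD h₂ h₃ h23)
  rw [hs1] at t1
  rw [hs2] at t2
  have tw : Tendsto (fun r : ℝ => D.winding w (p a + r • (D.arc h₃).dir 0)) (𝓝[>] 0)
      (𝓝 (D.winding w (p a))) := by
    refine (D.winding_continuousAt w (D.vertex_notMem_trace hD ha)).tendsto.comp ?_
    have : Continuous fun r : ℝ => p a + r • (D.arc h₃).dir 0 := by fun_prop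
    have := this.tendsto 0
    rw [zero_smul, add_zero] at this
    exact this.mono_left nhdsWithin_le_nhds
  refine tendsto_nhds_unique ((t1.add tw).sub t2) (tendsto_const_nhds.congr' ?_)
  filter_upwards [Ioc_mem_nhdsGT (one_pos : (0 : ℝ) < 1)] with r hr
  obtain ⟨hr1, hr2⟩ := hz r hr.1 hr.2
  rw [hC, trace_cons, trace_append, trace_cons] at hr1
  simp only [Set.mem_union, not_or] at hr1
  have hsym := D.arc_turning_symm hD h₂.symm hr1.2.2.1
  rw [hC, winding, winding_append, winding, winding] at hr2
  rw [hsym]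
  linarith

/-- In a drawing with all vertices on the outer face, three edges `a b₁`, `a b₂`, `a b₃` cannot be
completed to three closed walks through `a`, each of which uses two of the edges and misses the
end of the third: around `a`, one of the edges would have to start inside the closed walk
through the two others. -/
theorem not_fan (hD : D.IsPlanar) (hout : ∀ v, p v ∈ frontier D.outerFace)
    {a b₁ b₂ b₃ : V} (h₁ : G.Adj a b₁) (h₂ : G.Adj a b₂) (h₃ : G.Adj a b₃)
    (w₁₂ : G.Walk b₁ b₂) (w₂₃ : G.Walk b₂ b₃) (w₃₁ : G.Walk b₃ b₁)
    (ha₁₂ : a ∉ w₁₂.support) (ha₂₃ : a ∉ w₂₃.support) (ha₃₁ : a ∉ w₃₁.support)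
    (hb₁₂ : b₃ ∉ w₁₂.support) (hb₂₃ : b₁ ∉ w₂₃.support) (hb₃₁ : b₂ ∉ w₃₁.support) : False := by
  have r₁₂ := D.angle_relation hD hout h₁ h₂ h₃ w₁₂ ha₁₂ hb₁₂
  have r₂₃ := D.angle_relation hD hout h₂ h₃ h₁ w₂₃ ha₂₃ hb₂₃
  have r₃₁ := D.angle_relation hD hout h₃ h₁ h₂ w₃₁ ha₃₁ hb₃₁
  have n₁₂ : b₁ ≠ b₂ := by rintro rfl; exact hb₂₃ w₂₃.start_mem_support
  have n₁₃ : b₁ ≠ b₃ := by rintro rfl; exact hb₂₃ w₂₃.end_mem_support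
  have n₂₃ : b₂ ≠ b₃ := by rintro rfl; exact hb₁₂ w₁₂.end_mem_support
  have hw := D.winding_eq_zero_of_frontier (w₁₂.append (w₂₃.append w₃₁)) (hout a)
    (D.vertex_notMem_trace hD (by
      simp only [SimpleGraph.Walk.mem_support_append_iff, not_or]
      exact ⟨ha₁₂, ha₂₃, ha₃₁⟩))
  rw [winding_append, winding_append] at hw
  have s₁₂ := D.neg_div_initialDir_mem_slitPlane hD h₁ h₂ n₁₂
  have s₂₃ := D.neg_div_initialDir_mem_slitPlane hD h₂ h₃ n₂₃
  have s₃₁ := D.neg_div_initialDir_mem_slitPlane hD h₃ h₁ n₁₃.symm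
  have z₁ := (D.arc_isSimple hD h₁).initialDir_ne_zero
  have z₂ := (D.arc_isSimple hD h₂).initialDir_ne_zero
  have z₃ := (D.arc_isSimple hD h₃).initialDir_ne_zero
  generalize (D.arc h₁).initialDir = u₁ at *
  generalize (D.arc h₂).initialDir = u₂ at *
  generalize (D.arc h₃).initialDir = u₃ at *
  have hinv : ∀ {u v : ℂ}, -(u / v) ∈ Complex.slitPlane →
      (-(v / u)).arg = -(-(u / v)).arg := by
    intro u v h
    rw [← inv_div u v, ← inv_neg, Complex.arg_inv, if_neg (Complex.mem_slitPlane_iff_arg.1 h).1]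
  have hsum : (-(u₁ / u₂)).arg + (-(u₂ / u₃)).arg + (-(u₃ / u₁)).arg = 0 := by
    rw [hinv s₃₁] at r₁₂
    rw [hinv s₁₂] at r₂₃
    rw [hinv s₂₃] at r₃₁
    linarith
  have hangle := congrArg (fun x : ℝ => (x : Real.Angle)) hsum
  simp only [Real.Angle.coe_add, Real.Angle.coe_zero] at hangle
  rw [← Complex.arg_mul_coe_angle (neg_ne_zero.2 (div_ne_zero z₁ z₂))
      (neg_ne_zero.2 (div_ne_zero z₂ z₃)),
    ← Complex.arg_mul_coe_angle (mul_ne_zero (neg_ne_zero.2 (div_ne_zero z₁ z₂))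
      (neg_ne_zero.2 (div_ne_zero z₂ z₃))) (neg_ne_zero.2 (div_ne_zero z₃ z₁))] at hangle
  have e : -(u₁ / u₂) * -(u₂ / u₃) * -(u₃ / u₁) = -1 := by field_simp
  rw [e, Complex.arg_neg_one] at hangle
  exact Real.Angle.pi_ne_zero hangle

end PolylineDrawing
end RacSim

/-! ### Outerplanar graphs contain no fan -/

namespace RacSim

variable {V : Type*} {G : SimpleGraph V}

/-- `x` and `y` are joined by a walk all of whose vertices lie in `T`. -/
def JoinedIn (G : SimpleGraph V) (T : Set V) (x y : V) : Prop :=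
  ∃ w : G.Walk x y, ∀ z ∈ w.support, z ∈ T

namespace JoinedIn

variable {T T' : Set V} {x y z : V}

lemma refl (h : x ∈ T) : JoinedIn G T x x := ⟨.nil, by simpa using h⟩

lemma symm (h : JoinedIn G T x y) : JoinedIn G T y x := by
  obtain ⟨w, hw⟩ := h
  exact ⟨w.reverse, by simpa using hw⟩

lemma trans (h : JoinedIn G T x y) (h' : JoinedIn G T y z) : JoinedIn G T x z := by
  obtain ⟨w, hw⟩ := h
  obtain ⟨w', hw'⟩ := h'
  refine ⟨w.append w', fun u hu => ?_⟩
  rcases (SimpleGraph.Walk.mem_support_append_iff _ _).1 hu with hu | hu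
  · exact hw u hu
  · exact hw' u hu

lemma mono (h : JoinedIn G T x y) (hT : T ⊆ T') : JoinedIn G T' x y := by
  obtain ⟨w, hw⟩ := h
  exact ⟨w, fun u hu => hT (hw u hu)⟩

lemma of_adj (h : G.Adj x y) (hx : x ∈ T) (hy : y ∈ T) : JoinedIn G T x y :=
  ⟨.cons h .nil, by simp [hx, hy]⟩

lemma of_isChain_head {l : List V} (hl : (x :: l).IsChain G.Adj) (hT : ∀ z ∈ x :: l, z ∈ T)
    (hy : y ∈ x :: l) : JoinedIn G T x y := by
  induction l generalizing x with
  | nil =>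
    rw [List.mem_singleton] at hy
    subst hy
    exact refl (hT _ (by simp))
  | cons a l ih =>
    rw [List.isChain_cons_cons] at hl
    rw [List.mem_cons] at hy
    rcases hy with rfl | hy
    · exact refl (hT _ (by simp))
    · exact (of_adj hl.1 (hT _ (by simp)) (hT _ (by simp))).trans
        (ih hl.2 (fun z hz => hT z (List.mem_cons_of_mem _ hz)) hy)

/-- Any two members of a chain of adjacent vertices are joined within that chain. -/
lemma of_isChain {l : List V} (hl : l.IsChain G.Adj) (hT : ∀ z ∈ l, z ∈ T) (hx : x ∈ l)
    (hy : y ∈ l) : JoinedIn G T x y := by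
  cases l with
  | nil => simp at hx
  | cons a l => exact (of_isChain_head hl hT hx).symm.trans (of_isChain_head hl hT hy)

/-- A walk that leads into a set `P` contains a path that leads up to its first vertex in `P`. -/
lemma exists_chain_to {P : Set V} (h : JoinedIn G T x y) (hx : x ∉ P) (hy : y ∈ P) :
    ∃ c ∈ P, c ∈ T ∧ ∃ q : List V, (x :: (q ++ [c])).IsChain G.Adj ∧ (x :: q).Nodup ∧
      ∀ z ∈ x :: q, z ∈ T ∧ z ∉ P := by
  classical
  obtain ⟨w, hw⟩ := h
  have key : ∃ c ∈ P, c ∈ T ∧ ∃ y', G.Adj y' c ∧ JoinedIn G (T \ P) x y' := by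
    induction w with
    | nil => exact absurd hy hx
    | @cons u v w' huv w ih =>
      have hu : u ∈ T := hw u (by simp)
      by_cases hv : v ∈ P
      · exact ⟨v, hv, hw v (by simp), u, huv, refl ⟨hu, hx⟩⟩
      · obtain ⟨c, hc, hcT, y', hy', hj⟩ := ih hv hy (fun z hz => hw z (by simp [hz]))
        exact ⟨c, hc, hcT, y', hy',
          JoinedIn.trans (of_adj huv (T := T \ P) ⟨hu, hx⟩ ⟨hw v (by simp), hv⟩) hj⟩
  obtain ⟨c, hc, hcT, y', hy', w', hw'⟩ := key
  have hpath := w'.bypass_isPath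
  refine ⟨c, hc, hcT, w'.bypass.support.tail, ?_, ?_, ?_⟩
  · have := (w'.bypass.concat hy').isChain_adj_support
    rw [SimpleGraph.Walk.support_concat] at this
    rwa [← SimpleGraph.Walk.cons_tail_support w'.bypass, List.cons_append] at this
  · rw [SimpleGraph.Walk.cons_tail_support]
    exact hpath.support_nodup
  · rw [SimpleGraph.Walk.cons_tail_support]
    exact fun z hz => hw' z (w'.support_bypass_subset_support hz)

end JoinedIn

/-- No vertex `a` has three neighbours any two of which are joined by a walk that avoids `a` and
the third. -/
def NoFan (G : SimpleGraph V) : Prop :=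
  ∀ a b₁ b₂ b₃, G.Adj a b₁ → G.Adj a b₂ → G.Adj a b₃ → JoinedIn G {a, b₃}ᶜ b₁ b₂ →
    JoinedIn G {a, b₁}ᶜ b₂ b₃ → JoinedIn G {a, b₂}ᶜ b₃ b₁ → False

theorem IsOuterplanar.noFan (h : IsOuterplanar G) : NoFan G := by
  obtain ⟨p, D, hD, hout⟩ := h
  rintro a b₁ b₂ b₃ h₁ h₂ h₃ ⟨w₁₂, h₁₂⟩ ⟨w₂₃, h₂₃⟩ ⟨w₃₁, h₃₁⟩
  have key : ∀ {x y c : V} {w : G.Walk x y}, (∀ z ∈ w.support, z ∈ ({a, c} : Set V)ᶜ) →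
      a ∉ w.support ∧ c ∉ w.support := fun h =>
    ⟨fun h' => h _ h' (by simp), fun h' => h _ h' (by simp)⟩
  exact D.not_fan hD hout h₁ h₂ h₃ w₁₂ w₂₃ w₃₁ (key h₁₂).1 (key h₂₃).1 (key h₃₁).1
    (key h₁₂).2 (key h₂₃).2 (key h₃₁).2

/-- The list `a :: t` runs through the vertices of a cycle (or, if it has only two entries, of an
edge) of the graph induced on `S`. -/
structure IsCyclicList (G : SimpleGraph V) (S : Finset V) (a : V) (t : List V) : Prop where
  chain : (a :: (t ++ [a])).IsChain G.Adj
  nodup : (a :: t).Nodup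
  mem : ∀ x ∈ a :: t, x ∈ S

namespace IsCyclicList

variable {S : Finset V} {a c : V} {t t₁ t₂ : List V}

lemma rotate (h : IsCyclicList G S a (t₁ ++ c :: t₂)) : IsCyclicList G S c (t₂ ++ a :: t₁) := by
  obtain ⟨h1, h2, h3⟩ := h
  refine ⟨?_, ?_, ?_⟩
  · have e : a :: (t₁ ++ c :: t₂ ++ [a]) = (a :: t₁) ++ c :: (t₂ ++ [a]) := by simp
    rw [e, List.isChain_split] at h1
    have e' : c :: (t₂ ++ a :: t₁ ++ [c]) = (c :: t₂) ++ a :: (t₁ ++ [c]) := by simp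
    rw [e', List.isChain_split]
    exact ⟨by simpa using h1.2, by simpa using h1.1⟩
  · have hp : (c :: (t₂ ++ a :: t₁)).Perm (a :: (t₁ ++ c :: t₂)) :=
      (List.perm_append_comm (l₁ := c :: t₂) (l₂ := a :: t₁))
    exact hp.nodup_iff.2 h2
  · intro x hx
    apply h3
    simp only [List.mem_cons, List.mem_append] at hx ⊢
    tauto

lemma exists_rotate (h : IsCyclicList G S a t) (hc : c ∈ a :: t) :
    ∃ t', IsCyclicList G S c t' ∧ t'.length = t.length ∧ ∀ x, x ∈ c :: t' ↔ x ∈ a :: t := by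
  rw [List.mem_cons] at hc
  rcases hc with rfl | hc
  · exact ⟨t, h, rfl, fun _ => Iff.rfl⟩
  · obtain ⟨t₁, t₂, rfl⟩ := List.append_of_mem hc
    refine ⟨_, h.rotate, by simp; omega, fun x => ?_⟩
    simp only [List.mem_cons, List.mem_append]
    tauto

lemma ne_nil (h : IsCyclicList G S a t) : t ≠ [] := by
  rintro rfl
  have := h.chain
  simp at this

lemma isChain_tail (h : IsCyclicList G S a t) : t.IsChain G.Adj := by
  have := h.chain
  rw [← List.cons_append, List.isChain_append] at this
  exact this.1.of_cons

lemma adj_head {b : V} (h : IsCyclicList G S a (b :: t)) : G.Adj a b := by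
  have := h.chain
  rw [List.cons_append, List.isChain_cons_cons] at this
  exact this.1

lemma adj_last {b : V} (h : IsCyclicList G S a (t ++ [b])) : G.Adj a b := by
  have := h.chain
  have e : a :: (t ++ [b] ++ [a]) = (a :: t) ++ b :: [a] := by simp
  rw [e, List.isChain_split] at this
  exact (List.isChain_pair.1 this.2).symm

/-- A vertex off a longest cycle that is adjacent to it would give rise to a fan. -/
lemma not_adj_of_longest (hG : NoFan G) (h : IsCyclicList G S a t)
    (hmax : ∀ a' t', IsCyclicList G S a' t' → t'.length ≤ t.length)
    (hconn : ∀ x ∈ S, ∀ y ∈ S, x ≠ a → y ≠ a → JoinedIn G {z | z ∈ S ∧ z ≠ a} x y)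
    {y : V} (hy : y ∈ S) (hyt : y ∉ a :: t) : ¬ G.Adj a y := by
  intro hay
  have hya : y ≠ a := fun h' => hyt (by simp [h'])
  have hyt' : y ∉ t := fun h' => hyt (by simp [h'])
  obtain ⟨b, t', rfl⟩ := List.exists_cons_of_ne_nil h.ne_nil
  have hba : b ≠ a := by
    rintro rfl
    exact (List.nodup_cons.1 h.nodup).1 (by simp)
  obtain ⟨c, hc, -, q, hq1, hq2, hq3⟩ :=
    (hconn y hy b (h.mem b (by simp)) hya hba).exists_chain_to (P := {x | x ∈ b :: t'})
      hyt' (by simp)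
  have hc : c ∈ b :: t' := hc
  have hqS : ∀ z ∈ y :: q, z ∈ S ∧ z ≠ a ∧ z ∉ b :: t' := fun z hz =>
    ⟨(hq3 z hz).1.1, (hq3 z hz).1.2, (hq3 z hz).2⟩
  clear hq3
  generalize b :: t' = t at *
  obtain ⟨t₁, t₂, rfl⟩ := List.append_of_mem hc
  have hchain := h.chain
  have e : a :: (t₁ ++ c :: t₂ ++ [a]) = (a :: t₁) ++ c :: (t₂ ++ [a]) := by simp
  rw [e, List.isChain_split] at hchain
  have hnd := h.nodup
  have hdisj : ∀ z ∈ y :: q, z ∉ a :: (t₁ ++ c :: t₂) := fun z hz hz' => by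
    rcases List.mem_cons.1 hz' with rfl | hz'
    · exact (hqS _ hz).2.1 rfl
    · exact (hqS z hz).2.2 hz'
  by_cases ht₁ : t₁ = []
  · -- the detour through `y` replaces the edge `ac`
    subst ht₁
    have hnew : IsCyclicList G S a ((y :: q) ++ c :: t₂) := by
      refine ⟨?_, ?_, ?_⟩
      · have e : a :: ((y :: q) ++ c :: t₂ ++ [a]) = (a :: y :: q) ++ c :: (t₂ ++ [a]) := by simp
        rw [e, List.isChain_split]
        refine ⟨?_, hchain.2⟩
        simp only [List.cons_append, List.isChain_cons_cons] at hq1 ⊢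
        exact ⟨hay, hq1⟩
      · rw [List.nil_append, List.nodup_cons] at hnd
        rw [List.nodup_cons, List.nodup_append']
        refine ⟨?_, hq2, hnd.2, fun z hz hz' => hdisj z hz (by simp at hz' ⊢; tauto)⟩
        intro h'
        rcases List.mem_append.1 h' with h' | h'
        · exact hdisj a h' (by simp)
        · exact hnd.1 h'
      · intro x hx
        rcases List.mem_cons.1 hx with rfl | hx
        · exact h.mem _ (by simp)
        rcases List.mem_append.1 hx with hx | hx
        · exact (hqS x hx).1
        · exact h.mem x (by simp at hx ⊢; tauto)
    have := hmax _ _ hnew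
    simp at this
    omega
  by_cases ht₂ : t₂ = []
  · subst ht₂
    have hnew : IsCyclicList G S a (t₁ ++ c :: (y :: q).reverse) := by
      refine ⟨?_, ?_, ?_⟩
      · have e : a :: (t₁ ++ c :: (y :: q).reverse ++ [a]) =
          (a :: t₁) ++ c :: ((y :: q).reverse ++ [a]) := by simp
        rw [e, List.isChain_split]
        refine ⟨hchain.1, ?_⟩
        have h1 : (a :: y :: (q ++ [c])).IsChain G.Adj := by
          rw [List.isChain_cons_cons]
          exact ⟨hay, hq1⟩
        have h2 := List.isChain_reverse.2 (h1.imp fun _ _ h => h.symm)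
        simpa using h2
      · have e : a :: (t₁ ++ c :: (y :: q).reverse) =
          a :: (t₁ ++ c :: []) ++ (y :: q).reverse := by simp
        rw [e, List.nodup_append']
        exact ⟨hnd, List.nodup_reverse.2 hq2, fun z hz hz' => hdisj z (List.mem_reverse.1 hz') hz⟩
      · intro x hx
        have e : a :: (t₁ ++ c :: (y :: q).reverse) =
          a :: (t₁ ++ c :: []) ++ (y :: q).reverse := by simp
        rw [e, List.mem_append] at hx
        rcases hx with hx | hx
        · exact h.mem x hx
        · exact (hqS x (List.mem_reverse.1 hx)).1
    have := hmax _ _ hnew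
    simp at this
  -- now the neighbours of `a` on the cycle and `y` form a fan with centre `a`
  obtain ⟨b₁, s₁, rfl⟩ := List.exists_cons_of_ne_nil ht₁
  obtain ⟨s₂, b₂, rfl⟩ : ∃ s₂ b₂, t₂ = s₂ ++ [b₂] :=
    ⟨t₂.dropLast, t₂.getLast ht₂, (List.dropLast_append_getLast ht₂).symm⟩
  have hab₁ : G.Adj a b₁ := adj_head (t := s₁ ++ c :: (s₂ ++ [b₂])) h
  have hab₂ : G.Adj a b₂ := adj_last (t := b₁ :: s₁ ++ c :: s₂) (by simpa using h)
  have hct := h.isChain_tail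
  have hct' := List.isChain_split.1 hct
  have hqc := hq1.of_cons
  have hne₁ : ∀ z ∈ c :: (s₂ ++ [b₂]), z ≠ a ∧ z ≠ b₁ := by grind
  have hne₂ : ∀ z ∈ b₁ :: s₁ ++ [c], z ≠ a ∧ z ≠ b₂ := by grind
  have hnq : ∀ z ∈ y :: q, z ≠ a ∧ z ≠ b₁ ∧ z ≠ b₂ := by
    intro z hz
    have := hdisj z hz
    simp only [List.mem_cons, List.mem_append, not_or, List.cons_append] at this
    tauto
  have hyc : ∀ {T : Set V}, (∀ z ∈ y :: q, z ∈ T) → c ∈ T → JoinedIn G T y c := by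
    intro T hT hcT
    refine JoinedIn.of_isChain hq1 (fun z hz => ?_) (by simp) (by simp)
    rw [← List.cons_append, List.mem_append, List.mem_singleton] at hz
    rcases hz with hz | rfl
    · exact hT z hz
    · exact hcT
  refine hG a b₁ b₂ y hab₁ hab₂ hay ?_ ?_ ?_
  · refine JoinedIn.of_isChain hct (fun z hz => ?_) (by simp) (by simp)
    have h1 : z ≠ a := by
      rintro rfl
      exact (List.nodup_cons.1 h.nodup).1 hz
    have h2 : z ≠ y := by
      rintro rfl
      exact hdisj z (by simp) (List.mem_cons_of_mem _ hz)
    simp [h1, h2]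
  · refine (JoinedIn.of_isChain hct'.2 (T := {a, b₁}ᶜ) (x := b₂) (y := c) (fun z hz => ?_)
      (by simp) (by simp)).trans (hyc (fun z hz => ?_) ?_).symm
    · have := hne₁ z hz
      simp [this]
    · have := hnq z hz
      simp [this]
    · have := hne₁ c (by simp)
      simp [this]
  · refine (hyc (fun z hz => ?_) ?_).trans (JoinedIn.of_isChain hct'.1 (T := {a, b₂}ᶜ) (x := c)
      (y := b₁) (fun z hz => ?_) (by simp) (by simp))
    · have := hnq z hz
      simp [this]
    · have := hne₂ c (by simp)
      simp [this]
    · have := hne₂ z hz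
      simp [this]

/-- Two crossing chords would give rise to a fan. -/
lemma not_crossing (hG : NoFan G) {b d : V} {l₁ l₂ l₃ l₄ : List V}
    (h : IsCyclicList G S a (l₁ ++ c :: (l₂ ++ b :: (l₃ ++ d :: l₄)))) (hab : G.Adj a b)
    (hcd : G.Adj c d) : False := by
  obtain ⟨b₁, s₁, h₁⟩ : ∃ b₁ s₁, l₁ ++ [c] = b₁ :: s₁ :=
    List.exists_cons_of_ne_nil (by simp)
  obtain ⟨s₂, b₂, h₂⟩ : ∃ s₂ b₂, d :: l₄ = s₂ ++ [b₂] :=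
    ⟨_, _, (List.dropLast_append_getLast (List.cons_ne_nil d l₄)).symm⟩
  have e₁ : l₁ ++ c :: (l₂ ++ b :: (l₃ ++ d :: l₄)) =
      b₁ :: (s₁ ++ (l₂ ++ b :: (l₃ ++ d :: l₄))) := by
    rw [← List.cons_append (a := b₁), ← h₁]; simp
  have e₂ : l₁ ++ c :: (l₂ ++ b :: (l₃ ++ d :: l₄)) =
      (l₁ ++ c :: (l₂ ++ b :: (l₃ ++ s₂))) ++ [b₂] := by
    rw [h₂]; simp
  have hab₁ : G.Adj a b₁ := by
    rw [e₁] at h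
    exact h.adj_head
  have hab₂ : G.Adj a b₂ := by
    rw [e₂] at h
    exact h.adj_last
  have hct := h.isChain_tail
  have hnd := h.nodup
  have hc₁ : (l₁ ++ [c]).IsChain G.Adj := (List.isChain_split.1 hct).1
  have hc₂ : (c :: (l₂ ++ b :: (l₃ ++ d :: l₄))).IsChain G.Adj := (List.isChain_split.1 hct).2
  have hc₃ : (b :: (l₃ ++ d :: l₄)).IsChain G.Adj :=
    ((List.isChain_split (l₁ := c :: l₂)).1 hc₂).2
  have hc₄ : (d :: l₄).IsChain G.Adj := ((List.isChain_split (l₁ := b :: l₃)).1 hc₃).2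
  have hc₅ : (l₁ ++ c :: (l₂ ++ [b])).IsChain G.Adj := by
    have := ((List.isChain_split (l₁ := l₁ ++ c :: l₂) (c := b) (l₂ := l₃ ++ d :: l₄)).1
      (by simpa using hct)).1
    simpa using this
  have hb₁ : b₁ ∈ l₁ ++ [c] := by rw [h₁]; simp
  have hb₂ : b₂ ∈ d :: l₄ := by rw [h₂]; simp
  have hab' : ∀ z ∈ l₁ ++ c :: (l₂ ++ b :: (l₃ ++ d :: l₄)), z ≠ a := by
    rintro z hz rfl
    exact (List.nodup_cons.1 hnd).1 hz
  have hdis₁ := List.disjoint_of_nodup_append (l₁ := l₁ ++ [c])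
    (l₂ := l₂ ++ b :: (l₃ ++ d :: l₄)) (by simpa using hnd.of_cons)
  have hdis₂ := List.disjoint_of_nodup_append (l₁ := l₁ ++ c :: (l₂ ++ [b]))
    (l₂ := l₃ ++ d :: l₄) (by simpa using hnd.of_cons)
  refine hG a b₁ b₂ b hab₁ hab₂ hab ?_ ?_ ?_
  · have hT₁ : ∀ z ∈ l₁ ++ [c], z ∈ ({a, b} : Set V)ᶜ := by
      intro z hz
      have h1 : z ≠ a := hab' z (by simp at hz ⊢; tauto)
      have h2 : z ≠ b := by
        rintro rfl
        exact hdis₁ hz (by simp)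
      simp [h1, h2]
    have hT₂ : ∀ z ∈ d :: l₄, z ∈ ({a, b} : Set V)ᶜ := by
      intro z hz
      have h1 : z ≠ a := hab' z (by simp at hz ⊢; tauto)
      have h2 : z ≠ b := by
        rintro rfl
        exact hdis₂ (a := z) (by simp) (List.mem_append_right _ hz)
      simp [h1, h2]
    exact ((JoinedIn.of_isChain hc₁ hT₁ hb₁ (by simp)).trans
      (JoinedIn.of_adj hcd (hT₁ _ (by simp)) (hT₂ _ (by simp)))).trans
      (JoinedIn.of_isChain hc₄ hT₂ (by simp) hb₂)
  · refine JoinedIn.of_isChain hc₃ (fun z hz => ?_) (List.mem_cons_of_mem _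
      (List.mem_append_right _ hb₂)) (by simp)
    have h1 : z ≠ a := hab' z (by simp at hz ⊢; tauto)
    have h2 : z ≠ b₁ := by
      rintro rfl
      exact hdis₁ hb₁ (List.mem_append_right _ hz)
    simp [h1, h2]
  · refine JoinedIn.of_isChain hc₅ (fun z hz => ?_) (by simp) (by simp at hb₁ ⊢; tauto)
    have h1 : z ≠ a := hab' z (by simp at hz ⊢; tauto)
    have h2 : z ≠ b₂ := by
      rintro rfl
      exact hdis₂ hz (List.mem_append_right _ hb₂)
    simp [h1, h2]

end IsCyclicList
end RacSim

/-! ### Book orders of outerplanar graphs -/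

namespace RacSim

variable {V : Type*} {G : SimpleGraph V}

/-- `f` lists the vertices of `S` in the order of a one-page book embedding of the graph induced
on `S`: drawn as arcs above a line, no two edges cross. -/
structure IsBookOrder (G : SimpleGraph V) (S : Set V) (f : V → ℤ) : Prop where
  injOn : Set.InjOn f S
  not_crossing : ∀ a ∈ S, ∀ b ∈ S, ∀ c ∈ S, ∀ d ∈ S, G.Adj a b → G.Adj c d →
    f a < f c → f c < f b → f b < f d → False

namespace IsBookOrder

variable {S : Set V} {f : V → ℤ}

/-- Moving a terminal interval of a book order to the front yields a book order. -/
lemma rotate (h : IsBookOrder G S f) {M : ℤ} (hM : ∀ x ∈ S, ∀ y ∈ S, f x - f y < M) (t : ℤ) :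
    IsBookOrder G S (fun x => if f x ≤ t then f x else f x - M) := by
  refine ⟨fun x hx y hy hxy => ?_, fun a ha b hb c hc d hd hab hcd h1 h2 h3 => ?_⟩
  · have h1 := hM x hx y hy
    have h2 := hM y hy x hx
    apply h.injOn hx hy
    split_ifs at hxy <;> omega
  · have hac := hM a ha c hc
    have hca := hM c hc a ha
    have hbc := hM b hb c hc
    have hcb := hM c hc b hb
    have hbd := hM b hb d hd
    have hdb := hM d hd b hb
    have k1 := h.not_crossing a ha b hb c hc d hd hab hcd
    have k2 := h.not_crossing c hc d hd b hb a ha hcd hab.symm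
    have k3 := h.not_crossing b hb a ha d hd c hc hab.symm hcd.symm
    have k4 := h.not_crossing d hd c hc a ha b hb hcd.symm hab
    split_ifs at h1 h2 h3 <;>
    first
      | omega
      | exact k1 (by omega) (by omega) (by omega)
      | exact k2 (by omega) (by omega) (by omega)
      | exact k3 (by omega) (by omega) (by omega)
      | exact k4 (by omega) (by omega) (by omega)

lemma neg (h : IsBookOrder G S f) : IsBookOrder G S (fun x => -f x) := by
  refine ⟨fun x hx y hy hxy => h.injOn hx hy (neg_injective hxy),
    fun a ha b hb c hc d hd hab hcd h1 h2 h3 =>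
    h.not_crossing d hd c hc b hb a ha hcd.symm hab.symm ?_ ?_ ?_⟩ <;> omega

lemma exists_bound (hS : S.Finite) (f : V → ℤ) :
    ∃ M, ∀ x ∈ S, ∀ y ∈ S, f x - f y < M := by
  obtain ⟨B, hB⟩ := (hS.image fun x => |f x|).bddAbove
  refine ⟨2 * B + 1, fun x hx y hy => ?_⟩
  have h1 : |f x| ≤ B := hB ⟨x, hx, rfl⟩
  have h2 : |f y| ≤ B := hB ⟨y, hy, rfl⟩
  rw [abs_le] at h1 h2
  omega

lemma exists_last (h : IsBookOrder G S f) (hS : S.Finite) {v : V} (hv : v ∈ S) :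
    ∃ f', IsBookOrder G S f' ∧ ∀ x ∈ S, f' x ≤ f' v := by
  obtain ⟨M, hM⟩ := exists_bound hS f
  refine ⟨_, h.rotate hM (f v), fun x hx => ?_⟩
  have := hM x hx v hv
  simp only [le_refl, if_true]
  split_ifs <;> omega

lemma exists_first (h : IsBookOrder G S f) (hS : S.Finite) {v : V} (hv : v ∈ S) :
    ∃ f', IsBookOrder G S f' ∧ ∀ x ∈ S, f' v ≤ f' x := by
  obtain ⟨f', h1, h2⟩ := h.neg.exists_last hS hv
  exact ⟨_, h1.neg, fun x hx => neg_le_neg (h2 x hx)⟩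

open Classical in
/-- Book orders of two graphs that share one vertex combine to one of their union. -/
lemma glue {A B : Set V} {fA fB : V → ℤ} {v : V} (hA : IsBookOrder G A fA)
    (hB : IsBookOrder G B fB) (hvA : v ∈ A) (hvB : v ∈ B) (hAB : ∀ x ∈ A, x ∈ B → x = v)
    (hmax : ∀ x ∈ A, fA x ≤ fA v) (hmin : ∀ x ∈ B, fB v ≤ fB x)
    (hE : ∀ x ∈ A, ∀ y ∈ B, G.Adj x y → x = v ∨ y = v) :
    IsBookOrder G (A ∪ B) (fun x => if x ∈ A then fA x - fA v else fB x - fB v) := by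
  set f : V → ℤ := fun x => if x ∈ A then fA x - fA v else fB x - fB v with hf
  have fa : ∀ x ∈ A, f x = fA x - fA v := fun x hx => if_pos hx
  have fb : ∀ x ∈ B, f x = fB x - fB v := by
    intro x hx
    by_cases hxA : x ∈ A
    · rw [hAB x hxA hx, fa v hvA]; omega
    · exact if_neg hxA
  have fa0 : ∀ x ∈ A, f x ≤ 0 := fun x hx => by
    have := hmax x hx
    rw [fa x hx]; omega
  have fb0 : ∀ x ∈ B, 0 ≤ f x := fun x hx => by
    have := hmin x hx
    rw [fb x hx]; omega
  have zA : ∀ x ∈ A, f x = 0 → x = v := fun x hx h0 => hA.injOn hx hvA (by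
    rw [fa x hx] at h0; omega)
  have zB : ∀ x ∈ B, f x = 0 → x = v := fun x hx h0 => hB.injOn hx hvB (by
    rw [fb x hx] at h0; omega)
  have hedge : ∀ x ∈ A ∪ B, ∀ y ∈ A ∪ B, G.Adj x y → (x ∈ A ∧ y ∈ A) ∨ (x ∈ B ∧ y ∈ B) := by
    rintro x (hx | hx) y (hy | hy) hxy
    · exact Or.inl ⟨hx, hy⟩
    · rcases hE x hx y hy hxy with rfl | rfl
      · exact Or.inr ⟨hvB, hy⟩
      · exact Or.inl ⟨hx, hvA⟩
    · rcases hE y hy x hx hxy.symm with rfl | rfl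
      · exact Or.inr ⟨hx, hvB⟩
      · exact Or.inl ⟨hvA, hy⟩
    · exact Or.inr ⟨hx, hy⟩
  refine ⟨?_, fun a ha b hb c hc d hd hab hcd h1 h2 h3 => ?_⟩
  · rintro x (hx | hx) y (hy | hy) hxy
    · exact hA.injOn hx hy (by rw [fa x hx, fa y hy] at hxy; omega)
    · have h1 := fa0 x hx
      have h2 := fb0 y hy
      rw [zA x hx (by omega), zB y hy (by omega)]
    · have h1 := fb0 x hx
      have h2 := fa0 y hy
      rw [zB x hx (by omega), zA y hy (by omega)]
    · exact hB.injOn hx hy (by rw [fb x hx, fb y hy] at hxy; omega)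
  · rcases hedge a ha b hb hab with ⟨ha', hb'⟩ | ⟨ha', hb'⟩ <;>
    rcases hedge c hc d hd hcd with ⟨hc', hd'⟩ | ⟨hc', hd'⟩
    · rw [fa _ ha', fa _ hc'] at h1
      rw [fa _ hc', fa _ hb'] at h2
      rw [fa _ hb', fa _ hd'] at h3
      exact hA.not_crossing a ha' b hb' c hc' d hd' hab hcd (by omega) (by omega) (by omega)
    · have := fa0 b hb'
      have := fb0 c hc'
      omega
    · have := fb0 a ha'
      have := fa0 c hc'
      omega
    · rw [fb _ ha', fb _ hc'] at h1
      rw [fb _ hc', fb _ hb'] at h2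
      rw [fb _ hb', fb _ hd'] at h3
      exact hB.not_crossing a ha' b hb' c hc' d hd' hab hcd (by omega) (by omega) (by omega)

end IsBookOrder

lemma exists_split_of_idxOf_lt [DecidableEq V] {l : List V} {a c : V} (h : l.idxOf a < l.idxOf c)
    (hc : c ∈ l) :
    ∃ l₀ r, l = l₀ ++ a :: r ∧ ∀ x ∈ l, l.idxOf a < l.idxOf x →
      x ∈ r ∧ l.idxOf x = l₀.length + 1 + r.idxOf x := by
  have ha : a ∈ l := by
    rw [← List.idxOf_lt_length_iff]
    exact h.trans_le List.idxOf_le_length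
  obtain ⟨l₀, r, rfl, h0⟩ := List.eq_append_cons_of_mem ha
  refine ⟨l₀, r, rfl, fun x hx hax => ?_⟩
  rw [List.idxOf_append_of_notMem h0, List.idxOf_cons_self] at hax
  have hx0 : x ∉ l₀ := by
    intro hx0
    rw [List.idxOf_append_of_mem hx0] at hax
    have := List.idxOf_lt_length_iff.2 hx0
    omega
  rw [List.idxOf_append_of_notMem hx0] at hax
  have hxa : a ≠ x := by
    rintro rfl
    simp at hax
  refine ⟨?_, ?_⟩
  · simp only [List.mem_append, List.mem_cons] at hx
    rcases hx with hx | hx | hx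
    · exact absurd hx hx0
    · exact absurd hx.symm hxa
    · exact hx
  · rw [List.idxOf_append_of_notMem hx0, List.idxOf_cons_ne _ hxa]
    omega

/-- The order along a cycle through all vertices of `S` is a book order. -/
lemma IsCyclicList.isBookOrder [DecidableEq V] (hG : NoFan G) {S : Finset V} {a : V} {t : List V}
    (h : IsCyclicList G S a t) (hS : ∀ x ∈ S, x ∈ a :: t) :
    IsBookOrder G S (fun x => ((a :: t).idxOf x : ℤ)) := by
  refine ⟨fun x hx y hy hxy => ?_, fun x hx y hy z hz w hw hxy hzw h1 h2 h3 => ?_⟩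
  · exact (List.idxOf_inj (hS x hx)).1 (by exact_mod_cast hxy)
  · replace hx := hS x hx
    replace hy := hS y hy
    replace hz := hS z hz
    replace hw := hS w hw
    have h1 : (a :: t).idxOf x < (a :: t).idxOf z := by exact_mod_cast h1
    have h2 : (a :: t).idxOf z < (a :: t).idxOf y := by exact_mod_cast h2
    have h3 : (a :: t).idxOf y < (a :: t).idxOf w := by exact_mod_cast h3
    obtain ⟨l₀, r₀, e₀, k₀⟩ := exists_split_of_idxOf_lt h1 hz
    have hz₀ := k₀ z hz h1
    have hy₀ := k₀ y hy (by omega)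
    have hw₀ := k₀ w hw (by omega)
    obtain ⟨l₁, r₁, e₁, k₁⟩ := exists_split_of_idxOf_lt (l := r₀) (a := z) (c := y)
      (by omega) hy₀.1
    have hy₁ := k₁ y hy₀.1 (by omega)
    have hw₁ := k₁ w hw₀.1 (by omega)
    obtain ⟨l₂, r₂, e₂, k₂⟩ := exists_split_of_idxOf_lt (l := r₁) (a := y) (c := w)
      (by omega) hw₁.1
    have hw₂ := k₂ w hw₁.1 (by omega)
    obtain ⟨l₃, l₄, rfl⟩ := List.append_of_mem hw₂.1
    subst e₂ e₁
    cases l₀ with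
    | nil =>
      rw [List.nil_append, List.cons.injEq] at e₀
      obtain ⟨rfl, rfl⟩ := e₀
      exact h.not_crossing hG hxy hzw
    | cons b l₀ =>
      rw [List.cons_append, List.cons.injEq] at e₀
      obtain ⟨rfl, rfl⟩ := e₀
      have := h.rotate
      simp only [List.append_assoc, List.cons_append] at this
      exact this.not_crossing hG hxy hzw

open Classical in
/-- If no vertex of `S` separates two others, then a longest cycle passes through all vertices of
`S`, and its order is a book order. -/
lemma exists_bookOrder_of_joined (hG : NoFan G) {S : Finset V} (h3 : 3 ≤ S.card)
    (hconn : ∀ v ∈ S, ∀ x ∈ S, ∀ y ∈ S, x ≠ v → y ≠ v → JoinedIn G {z | z ∈ S ∧ z ≠ v} x y) :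
    ∃ f, IsBookOrder G S f := by
  -- the whole of `S` is connected, as `S` has a third vertex to leave out
  have hconn' : ∀ x ∈ S, ∀ y ∈ S, JoinedIn G {z | z ∈ S} x y := by
    intro x hx y hy
    obtain ⟨v, hv, hvxy⟩ : ∃ v ∈ S, v ∉ ({x, y} : Finset V) := by
      by_contra hcon
      push Not at hcon
      have h1 := Finset.card_le_card hcon
      have h2 := Finset.card_le_two (a := x) (b := y)
      omega
    simp only [Finset.mem_insert, Finset.mem_singleton, not_or] at hvxy
    exact (hconn v hv x hx y hy (Ne.symm hvxy.1) (Ne.symm hvxy.2)).mono fun z hz => hz.1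
  -- an edge between two parts of `S`
  have hedge : ∀ (P : Set V), ∀ x ∈ S, x ∉ P → ∀ y ∈ S, y ∈ P →
      ∃ u ∈ S, u ∉ P ∧ ∃ c ∈ S, c ∈ P ∧ G.Adj u c := by
    intro P x hx hxP y hy hyP
    obtain ⟨c, hcP, hcS, q, hq1, -, hq3⟩ := (hconn' x hx y hy).exists_chain_to hxP hyP
    obtain ⟨q', u, hq'⟩ : ∃ q' u, x :: q = q' ++ [u] :=
      ⟨_, _, (List.dropLast_append_getLast (List.cons_ne_nil x q)).symm⟩
    have hu := hq3 u (by rw [hq']; simp)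
    refine ⟨u, hu.1, hu.2, c, hcS, hcP, ?_⟩
    rw [← List.cons_append, hq', List.append_assoc, List.isChain_append] at hq1
    exact List.isChain_pair.1 hq1.2.1
  have hex : ∃ k a t, IsCyclicList G S a t ∧ t.length = k := by
    obtain ⟨x, hx, y, hy, hxy⟩ := Finset.one_lt_card.1 (by omega : 1 < S.card)
    obtain ⟨u, hu, huP, c, hc, hcP, huc⟩ := hedge {y} x hx (by simpa using hxy) y hy rfl
    refine ⟨1, u, [c], ⟨?_, ?_, ?_⟩, rfl⟩
    · simp [huc, huc.symm]
    · simp [huc.ne]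
    · simp [hu, hc]
  have hbound : ∀ k, (∃ a t, IsCyclicList G S a t ∧ t.length = k) → k ≤ S.card := by
    rintro k ⟨a, t, h, rfl⟩
    have h1 := List.toFinset_card_of_nodup h.nodup
    have h2 : (a :: t).toFinset ⊆ S := fun x hx => h.mem x (List.mem_toFinset.1 hx)
    have h3 := Finset.card_le_card h2
    simp only [List.length_cons] at h1
    omega
  obtain ⟨k, hk⟩ := hex
  obtain ⟨a, t, hat, hlen⟩ := Nat.findGreatest_spec
    (P := fun k => ∃ a t, IsCyclicList G S a t ∧ t.length = k) (hbound k hk) hk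
  have hmax : ∀ a' t', IsCyclicList G S a' t' → t'.length ≤ t.length := by
    intro a' t' h'
    rw [hlen]
    exact Nat.le_findGreatest (hbound _ ⟨a', t', h', rfl⟩) ⟨a', t', h', rfl⟩
  refine ⟨_, hat.isBookOrder hG fun y hy => ?_⟩
  by_contra hyt
  obtain ⟨u, hu, hut, c, hc, hct, huc⟩ := hedge {z | z ∈ a :: t} y hy hyt a
    (hat.mem a (by simp)) (by simp)
  obtain ⟨t', ht', hlen', hmem⟩ := hat.exists_rotate hct
  refine ht'.not_adj_of_longest hG (by rw [hlen']; exact hmax)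
    (hconn c hc) hu ?_ huc.symm
  rw [hmem]
  exact hut

open Classical in
theorem exists_bookOrder_finset [Finite V] (hG : NoFan G) (S : Finset V) :
    ∃ f, IsBookOrder G S f := by
  induction S using Finset.strongInduction with
  | H S ih =>
    by_cases hsep : ∀ v ∈ S, ∀ x ∈ S, ∀ y ∈ S, x ≠ v → y ≠ v →
        JoinedIn G {z | z ∈ S ∧ z ≠ v} x y
    · by_cases h3 : 3 ≤ S.card
      · exact exists_bookOrder_of_joined hG h3 hsep
      · obtain ⟨m, ⟨e⟩⟩ := Finite.exists_equiv_fin V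
        refine ⟨fun x => ((e x : ℕ) : ℤ), fun x _ y _ hxy => ?_,
          fun a ha b hb c hc d _ _ _ h1 h2 _ => h3 ?_⟩
        · exact e.injective (Fin.ext (by exact_mod_cast hxy))
        · rw [← Finset.card_eq_three.2 ⟨a, b, c, ?_, ?_, ?_, rfl⟩]
          · refine Finset.card_le_card fun x hx => ?_
            simp only [Finset.mem_insert, Finset.mem_singleton] at hx
            rcases hx with rfl | rfl | rfl <;> assumption
          all_goals (rintro rfl; omega)
    · push Not at hsep
      obtain ⟨v, hv, x, hx, y, hy, hxv, hyv, hxy⟩ := hsep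
      -- split `S` at the cut vertex `v`
      set T : Set V := {z | z ∈ S ∧ z ≠ v} with hT
      set A := S.filter fun z => z = v ∨ JoinedIn G T x z with hA
      set B := S.filter fun z => z = v ∨ ¬ JoinedIn G T x z with hB
      have hAS : A ⊂ S := Finset.filter_ssubset.2 ⟨y, hy, by tauto⟩
      have hBS : B ⊂ S := Finset.filter_ssubset.2 ⟨x, hx, by
        have : JoinedIn G T x x := JoinedIn.refl ⟨hx, hxv⟩
        tauto⟩
      obtain ⟨fA, hfA⟩ := ih A hAS
      obtain ⟨fB, hfB⟩ := ih B hBS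
      have hvA : v ∈ A := by simp [hA, hv]
      have hvB : v ∈ B := by simp [hB, hv]
      obtain ⟨fA, hfA, hmax⟩ := hfA.exists_last A.finite_toSet hvA
      obtain ⟨fB, hfB, hmin⟩ := hfB.exists_first B.finite_toSet hvB
      have hglue := hfA.glue hfB hvA hvB ?_ hmax hmin ?_
      · have hun : (A : Set V) ∪ B = S := by
          ext z
          simp only [hA, hB, Finset.coe_filter, Set.mem_union, Set.mem_ofPred_eq, Finset.mem_coe]
          tauto
        rw [hun] at hglue
        exact ⟨_, hglue⟩
      · intro z hzA hzB
        simp only [hA, hB, Finset.coe_filter, Set.mem_ofPred_eq] at hzA hzB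
        tauto
      · intro z hzA w hwB hzw
        simp only [hA, hB, Finset.coe_filter, Set.mem_ofPred_eq] at hzA hwB
        by_contra hcon
        push Not at hcon
        have hzT : z ∈ T := ⟨hzA.1, hcon.1⟩
        have hwT : w ∈ T := ⟨hwB.1, hcon.2⟩
        have hxz : JoinedIn G T x z := hzA.2.resolve_left hcon.1
        exact (hwB.2.resolve_left hcon.2) (hxz.trans (JoinedIn.of_adj hzw hzT hwT))

/-- An outerplanar graph has a one-page book embedding. -/
theorem IsOuterplanar.exists_bookOrder [Finite V] (h : IsOuterplanar G) :
    ∃ f, IsBookOrder G Set.univ f := by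
  cases nonempty_fintype V
  obtain ⟨f, hf⟩ := exists_bookOrder_finset h.noFan Finset.univ
  rw [Finset.coe_univ] at hf
  exact ⟨f, hf⟩

end RacSim

/-! ### Layouts on two pages -/

namespace RacSim

/-- The sign of a page: `1` for the upper page (`true`) and `-1` for the lower page (`false`). -/
def sg : Bool → ℤ
  | true => 1
  | false => -1

/-- Affine coordinates of the plane, given by the map from coordinates to points. -/
structure IsFrame (φ : ℝ → ℝ → Plane) : Prop where
  injective : ∀ {x y x' y'}, φ x y = φ x' y' → x = x' ∧ y = y'
  affine : ∀ {a b : ℝ}, a + b = 1 → ∀ x y x' y' : ℝ,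
    a • φ x y + b • φ x' y' = φ (a * x + b * x') (a * y + b * y')

/-- The numerical data of a drawing on two pages. The vertex `v` has coordinates `(X v, Y v)`, and
the columns from `lo v` to `hi v` are reserved for it. The edge with tail `t` and head `h` on page
`b` leaves `t` vertically in column `X t` to the row `height b t h`, follows that row to the column
`slot b t h`, follows that column back to the row next to `h`, and ends with a slanted segment. -/
structure Layout (V : Type*) where
  X : V → ℝ
  Y : V → ℝ
  lo : V → ℝ
  hi : V → ℝ
  slot : Bool → V → V → ℝ
  height : Bool → V → V → ℝ

namespace Layout

variable {V : Type*}

/-- The edge with tail `t` and head `h` on page `b` as a polyline. -/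
def arc (L : Layout V) (φ : ℝ → ℝ → Plane) (b : Bool) (t h : V) : Polyline where
  bends := 3
  pt := ![φ (L.X t) (L.Y t), φ (L.X t) (L.height b t h), φ (L.slot b t h) (L.height b t h),
    φ (L.slot b t h) (L.Y h + sg b), φ (L.X h) (L.Y h)]

/-- The conditions under which the layout yields a planar drawing of the edges described by `R`,
where `R b t h` says that there is an edge with tail `t` and head `h` on page `b`. -/
structure IsValid (L : Layout V) (R : Bool → V → V → Prop) : Prop where
  ne : ∀ {b t h}, R b t h → t ≠ h
  lo_le : ∀ v, L.lo v ≤ L.X v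
  le_hi : ∀ v, L.X v ≤ L.hi v
  box : ∀ {v w}, v ≠ w → L.hi v < L.lo w ∨ L.hi w < L.lo v
  lo_le_slot : ∀ {b t h}, R b t h → L.lo h ≤ L.slot b t h
  slot_le_hi : ∀ {b t h}, R b t h → L.slot b t h ≤ L.hi h
  slot_lt : ∀ {b t h}, R b t h → 0 < sg b * (L.X h - L.slot b t h)
  lt_slot : ∀ {b t h}, R b t h → 0 < sg b * (L.slot b t h - L.X t)
  lt_height : ∀ {b t h}, R b t h → ∀ v, 0 < sg b * (L.height b t h - L.Y v)
  lt_height' : ∀ {b t h t' h'}, R b t h → R b t' h' → 1 < sg b * (L.height b t h - L.Y h')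
  pair : ∀ {b t h t' h'}, R b t h → R b t' h' → (t ≠ t' ∨ h ≠ h') → t ≠ t' ∧
    (0 < sg b * (L.X t' - L.slot b t h) ∨ 0 < sg b * (L.X t - L.slot b t' h') ∨
      (0 < sg b * (L.X t' - L.X t) ∧ 0 < sg b * (L.slot b t h - L.slot b t' h') ∧
        0 < sg b * (L.height b t h - L.height b t' h')) ∨
      (0 < sg b * (L.X t - L.X t') ∧ 0 < sg b * (L.slot b t' h' - L.slot b t h) ∧
        0 < sg b * (L.height b t' h' - L.height b t h)))

/-- The point with coordinates `(x, y)` satisfies the equation and the inequalities that describe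
the `i`-th segment of an edge. -/
def OnSeg (L : Layout V) (b : Bool) (t h : V) (x y : ℝ) : Fin 4 → Prop
  | 0 => x = L.X t ∧ 0 ≤ sg b * (y - L.Y t) ∧ 0 ≤ sg b * (L.height b t h - y)
  | 1 => y = L.height b t h ∧ 0 ≤ sg b * (x - L.X t) ∧ 0 ≤ sg b * (L.slot b t h - x)
  | 2 => x = L.slot b t h ∧ 1 ≤ sg b * (y - L.Y h) ∧ 0 ≤ sg b * (L.height b t h - y)
  | 3 => 0 ≤ sg b * (x - L.slot b t h) ∧ 0 ≤ sg b * (L.X h - x) ∧ 0 ≤ sg b * (y - L.Y h) ∧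
      sg b * (y - L.Y h) ≤ 1 ∧ L.X h - x = (L.X h - L.slot b t h) * (sg b * (y - L.Y h))

lemma sg_cases (b : Bool) : (sg b : ℝ) = 1 ∨ (sg b : ℝ) = -1 := by
  cases b <;> simp [sg]

lemma mem_segment_frame {φ : ℝ → ℝ → Plane} (hφ : IsFrame φ) {x y x' y' : ℝ} {z : Plane}
    (hz : z ∈ segment ℝ (φ x y) (φ x' y')) :
    ∃ θ : ℝ, 0 ≤ θ ∧ θ ≤ 1 ∧ z = φ (x + θ * (x' - x)) (y + θ * (y' - y)) := by
  obtain ⟨a, c, ha, hc, hac, rfl⟩ := hz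
  refine ⟨c, hc, by linarith, ?_⟩
  rw [hφ.affine hac]
  obtain rfl : a = 1 - c := by linarith
  congr 1 <;> ring

variable {L : Layout V} {R : Bool → V → V → Prop} {φ : ℝ → ℝ → Plane}

lemma IsValid.exists_onSeg (hL : L.IsValid R) (hφ : IsFrame φ) {b : Bool} {t h : V}
    (hR : R b t h) {i : Fin 4} {z : Plane} (hz : z ∈ (L.arc φ b t h).seg i) :
    ∃ x y, z = φ x y ∧ L.OnSeg b t h x y i := by
  have h1 := hL.slot_lt hR
  have h2 := hL.lt_slot hR
  have h3 := hL.lt_height hR t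
  have h4 := hL.lt_height' hR hR
  fin_cases i
  · obtain ⟨θ, h0, h1, rfl⟩ := mem_segment_frame hφ hz
    refine ⟨_, _, rfl, by ring, ?_, ?_⟩
    · have := mul_nonneg h0 h3.le
      linarith
    · have := mul_nonneg (sub_nonneg.2 h1) h3.le
      linarith
  · obtain ⟨θ, h0, h1, rfl⟩ := mem_segment_frame hφ hz
    refine ⟨_, _, rfl, by ring, ?_, ?_⟩
    · have := mul_nonneg h0 h2.le
      linarith
    · have := mul_nonneg (sub_nonneg.2 h1) h2.le
      linarith
  · obtain ⟨θ, h0, h1, rfl⟩ := mem_segment_frame hφ hz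
    have h5 : (sg b : ℝ) * sg b = 1 := by rcases sg_cases b with h | h <;> rw [h] <;> norm_num
    refine ⟨_, _, rfl, by ring, ?_, ?_⟩
    · have h6 := mul_nonneg (sub_nonneg.2 h1) (sub_nonneg.2 h4.le)
      linear_combination h6 - θ * h5
    · have h6 := mul_nonneg h0 (sub_nonneg.2 h4.le)
      linear_combination h6 + θ * h5
  · obtain ⟨θ, h0, h2, rfl⟩ := mem_segment_frame hφ hz
    have h5 : (sg b : ℝ) * sg b = 1 := by rcases sg_cases b with h | h <;> rw [h] <;> norm_num
    have e : (sg b : ℝ) * (L.Y h + sg b + θ * (L.Y h - (L.Y h + sg b)) - L.Y h) = 1 - θ := by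
      linear_combination (1 - θ) * h5
    refine ⟨_, _, rfl, ?_, ?_, ?_, ?_, ?_⟩
    · have := mul_nonneg h0 h1.le
      linarith
    · have := mul_nonneg (sub_nonneg.2 h2) h1.le
      linarith
    · rw [e]; linarith
    · rw [e]; linarith
    · rw [e]; ring

/-- The columns reserved for two vertices are disjoint. -/
lemma IsValid.eq_of_mem_box (hL : L.IsValid R) {v w : V} {x : ℝ} (hv : L.lo v ≤ x)
    (hv' : x ≤ L.hi v) (hw : L.lo w ≤ x) (hw' : x ≤ L.hi w) : v = w := by
  by_contra hne
  rcases hL.box hne with h | h <;> linarith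

lemma IsValid.X_injective (hL : L.IsValid R) {v w : V} (h : L.X v = L.X w) : v = w :=
  hL.eq_of_mem_box (hL.lo_le v) (hL.le_hi v) (h ▸ hL.lo_le w) (h ▸ hL.le_hi w)

lemma IsValid.onSeg_two_box (hL : L.IsValid R) {b : Bool} {t h : V} (hR : R b t h) {x y : ℝ}
    (hz : L.OnSeg b t h x y 2) : L.lo h ≤ x ∧ x ≤ L.hi h := by
  rw [hz.1]
  exact ⟨hL.lo_le_slot hR, hL.slot_le_hi hR⟩

lemma IsValid.onSeg_three_box (hL : L.IsValid R) {b : Bool} {t h : V} (hR : R b t h) {x y : ℝ}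
    (hz : L.OnSeg b t h x y 3) : L.lo h ≤ x ∧ x ≤ L.hi h := by
  obtain ⟨h1, h2, -⟩ := hz
  have h3 := hL.lo_le_slot hR
  have h4 := hL.slot_le_hi hR
  have h5 := hL.lo_le h
  have h6 := hL.le_hi h
  rcases sg_cases b with hb | hb <;> rw [hb] at h1 h2 <;> constructor <;> linarith

/-- A point of the slanted segment in the column of the head is the head. -/
lemma IsValid.onSeg_three_eq_of_x (hL : L.IsValid R) {b : Bool} {t h : V} (hR : R b t h) {x y : ℝ}
    (hz : L.OnSeg b t h x y 3) (hx : x = L.X h) : y = L.Y h := by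
  obtain ⟨-, -, -, -, h1⟩ := hz
  have h2 := hL.slot_lt hR
  rw [hx, sub_self, eq_comm, mul_eq_zero] at h1
  rcases sg_cases b with hb | hb <;> rw [hb] at h1 h2 <;> rcases h1 with h1 | h1 <;> linarith

lemma onSeg_three_eq_of_y {b : Bool} {t h : V} {x y : ℝ} (hz : L.OnSeg b t h x y 3)
    (hy : y = L.Y h) : x = L.X h := by
  obtain ⟨-, -, -, -, h1⟩ := hz
  rw [hy] at h1
  linarith

/-- The vertical segment at the tail stays out of the columns of all other vertices. -/
lemma IsValid.onSeg_zero_box (hL : L.IsValid R) {b : Bool} {t h v : V} {x y : ℝ}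
    (hz : L.OnSeg b t h x y 0) (h1 : L.lo v ≤ x) (h2 : x ≤ L.hi v) : t = v := by
  rw [hz.1] at h1 h2
  exact hL.eq_of_mem_box (hL.lo_le t) (hL.le_hi t) h1 h2

/-- Two edges on the same page meet only in common vertices. -/
lemma IsValid.meet_same_page (hL : L.IsValid R) {b : Bool} {t h t' h' : V} (hR : R b t h)
    (hR' : R b t' h') (hne : t ≠ t' ∨ h ≠ h') {x y : ℝ} {i j : Fin 4} (hij : i ≤ j)
    (hi : L.OnSeg b t h x y i) (hj : L.OnSeg b t' h' x y j) :
    ∃ v, (v = t ∨ v = h) ∧ (v = t' ∨ v = h') ∧ x = L.X v ∧ y = L.Y v := by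
  obtain ⟨htt, hpair⟩ := hL.pair hR hR' hne
  have s1 := hL.slot_lt hR
  have s2 := hL.lt_slot hR
  have s1' := hL.slot_lt hR'
  have s2' := hL.lt_slot hR'
  have k1 := hL.lt_height' hR hR'
  have k2 := hL.lt_height' hR' hR
  have hslot : L.slot b t h ≠ L.slot b t' h' := by
    intro he
    rcases sg_cases b with hb | hb <;> rw [hb] at hpair s2 s2' <;>
      rcases hpair with h | h | ⟨_, h, _⟩ | ⟨_, h, _⟩ <;> linarith
  fin_cases i <;> fin_cases j <;>
    first
    | exact absurd hij (by decide)
    | skip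
  · exact absurd (hL.X_injective (hi.1.symm.trans hj.1)) htt
  · obtain ⟨a1, a2, a3⟩ := hi
    obtain ⟨c1, c2, c3⟩ := hj
    exfalso
    subst a1 c1
    rcases hpair with h | h | ⟨h1, h2, h3⟩ | ⟨h1, h2, h3⟩ <;> linarith
  · exfalso
    obtain ⟨b1, b2⟩ := hL.onSeg_two_box hR' hj
    obtain rfl := hL.onSeg_zero_box hi b1 b2
    have e : L.X t = L.slot b t' t := hi.1.symm.trans hj.1
    rw [e, sub_self, mul_zero] at s1'
    exact lt_irrefl _ s1'
  · obtain ⟨b1, b2⟩ := hL.onSeg_three_box hR' hj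
    obtain rfl := hL.onSeg_zero_box hi b1 b2
    exact ⟨t, Or.inl rfl, Or.inr rfl, hi.1, hL.onSeg_three_eq_of_x hR' hj hi.1⟩
  · obtain ⟨a1, a2, a3⟩ := hi
    obtain ⟨c1, c2, c3⟩ := hj
    exfalso
    have e := a1.symm.trans c1
    rw [e] at hpair
    rcases hpair with h | h | ⟨h1, h2, h3⟩ | ⟨h1, h2, h3⟩ <;> linarith
  · obtain ⟨a1, a2, a3⟩ := hi
    obtain ⟨c1, c2, c3⟩ := hj
    exfalso
    subst a1 c1
    rcases hpair with h | h | ⟨h1, h2, h3⟩ | ⟨h1, h2, h3⟩ <;> linarith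
  · exfalso
    have a1 := hi.1
    obtain ⟨-, -, -, c1, -⟩ := hj
    rw [a1] at c1
    linarith
  · exact absurd (hi.1.symm.trans hj.1) hslot
  · exfalso
    obtain ⟨b1, b2⟩ := hL.onSeg_two_box hR hi
    obtain ⟨b3, b4⟩ := hL.onSeg_three_box hR' hj
    obtain rfl := hL.eq_of_mem_box b1 b2 b3 b4
    obtain ⟨a1, a2, a3⟩ := hi
    obtain ⟨-, -, -, c1, c2⟩ := hj
    rw [le_antisymm c1 a2, mul_one, a1] at c2
    exact hslot (by linarith)
  · obtain ⟨b1, b2⟩ := hL.onSeg_three_box hR hi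
    obtain ⟨b3, b4⟩ := hL.onSeg_three_box hR' hj
    obtain rfl := hL.eq_of_mem_box b1 b2 b3 b4
    have e : y = L.Y h := by
      have e1 := hi.2.2.2.2.symm.trans hj.2.2.2.2
      rw [← sub_eq_zero, ← sub_mul, mul_eq_zero] at e1
      rcases e1 with e1 | e1
      · exact absurd (by linarith) hslot
      · rcases sg_cases b with hb | hb <;> rw [hb] at e1 <;> linarith
    exact ⟨h, Or.inr rfl, Or.inr rfl, onSeg_three_eq_of_y hi e, e⟩

/-- Two edges on different pages meet only in common vertices. -/
lemma IsValid.meet_other_page (hL : L.IsValid R) {b b' : Bool} {t h t' h' : V} (hR : R b t h)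
    (hR' : R b' t' h') (hb : b ≠ b') {x y : ℝ} {i j : Fin 4} (hij : i ≤ j)
    (hi : L.OnSeg b t h x y i) (hj : L.OnSeg b' t' h' x y j) :
    ∃ v, (v = t ∨ v = h) ∧ (v = t' ∨ v = h') ∧ x = L.X v ∧ y = L.Y v := by
  have hsg : (sg b' : ℝ) = -sg b := by cases b <;> cases b' <;> simp_all [sg]
  have s1 := hL.slot_lt hR
  have s2 := hL.lt_slot hR
  have s1' := hL.slot_lt hR'
  have s2' := hL.lt_slot hR'
  have k1 := hL.lt_height hR t'
  have k2 := hL.lt_height hR h'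
  have k3 := hL.lt_height hR' t
  have k4 := hL.lt_height hR' h
  have k5 := hL.lt_height hR' t'
  fin_cases i <;> fin_cases j <;>
    first
    | exact absurd hij (by decide)
    | skip
  · obtain rfl := hL.X_injective (hi.1.symm.trans hj.1)
    refine ⟨t, Or.inl rfl, Or.inl rfl, hi.1, ?_⟩
    obtain ⟨a1, a2, a3⟩ := hi
    obtain ⟨c1, c2, c3⟩ := hj
    rw [hsg] at *
    rcases sg_cases b with hb | hb <;> rw [hb] at a2 c2 <;> linarith
  · obtain ⟨a1, a2, a3⟩ := hi
    obtain ⟨c1, c2, c3⟩ := hj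
    exfalso
    rw [← c1, hsg] at k3
    linarith
  · exfalso
    obtain ⟨b1, b2⟩ := hL.onSeg_two_box hR' hj
    obtain rfl := hL.onSeg_zero_box hi b1 b2
    have e : L.X t = L.slot b' t' t := hi.1.symm.trans hj.1
    rw [e, sub_self, mul_zero] at s1'
    exact lt_irrefl _ s1'
  · obtain ⟨b1, b2⟩ := hL.onSeg_three_box hR' hj
    obtain rfl := hL.onSeg_zero_box hi b1 b2
    exact ⟨t, Or.inl rfl, Or.inr rfl, hi.1, hL.onSeg_three_eq_of_x hR' hj hi.1⟩
  · exfalso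
    rw [← hj.1, hsg] at k5
    rw [← hi.1] at k1
    linarith
  · exfalso
    obtain ⟨c1, c2, c3⟩ := hj
    rw [hsg] at c2
    rw [← hi.1] at k2
    linarith
  · exfalso
    obtain ⟨c1, c2, c3, c4, c5⟩ := hj
    rw [hsg] at c3
    rw [← hi.1] at k2
    linarith
  · exfalso
    obtain ⟨b1, b2⟩ := hL.onSeg_two_box hR hi
    obtain ⟨b3, b4⟩ := hL.onSeg_two_box hR' hj
    obtain rfl := hL.eq_of_mem_box b1 b2 b3 b4
    rw [← hi.1] at s1
    rw [← hj.1, hsg] at s1'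
    linarith
  · exfalso
    obtain ⟨b1, b2⟩ := hL.onSeg_two_box hR hi
    obtain ⟨b3, b4⟩ := hL.onSeg_three_box hR' hj
    obtain rfl := hL.eq_of_mem_box b1 b2 b3 b4
    rw [← hi.1] at s1
    obtain ⟨c1, c2, c3, c4, c5⟩ := hj
    rw [hsg] at c2
    linarith
  · obtain ⟨b1, b2⟩ := hL.onSeg_three_box hR hi
    obtain ⟨b3, b4⟩ := hL.onSeg_three_box hR' hj
    obtain rfl := hL.eq_of_mem_box b1 b2 b3 b4
    have e : y = L.Y h := by
      obtain ⟨a1, a2, a3, a4, a5⟩ := hi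
      obtain ⟨c1, c2, c3, c4, c5⟩ := hj
      rw [hsg] at c3
      rcases sg_cases b with hb | hb <;> rw [hb] at a3 c3 <;> linarith
    exact ⟨h, Or.inr rfl, Or.inr rfl, onSeg_three_eq_of_y hi e, e⟩

lemma IsValid.meet (hL : L.IsValid R) {b b' : Bool} {t h t' h' : V} (hR : R b t h)
    (hR' : R b' t' h') (hne : b ≠ b' ∨ t ≠ t' ∨ h ≠ h') {x y : ℝ} {i j : Fin 4}
    (hi : L.OnSeg b t h x y i) (hj : L.OnSeg b' t' h' x y j) :
    ∃ v, (v = t ∨ v = h) ∧ (v = t' ∨ v = h') ∧ x = L.X v ∧ y = L.Y v := by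
  by_cases hb : b = b'
  · subst hb
    replace hne := hne.resolve_left (fun h => h rfl)
    rcases le_total i j with hij | hij
    · exact hL.meet_same_page hR hR' hne hij hi hj
    · obtain ⟨v, h1, h2, h3⟩ := hL.meet_same_page hR' hR (hne.imp Ne.symm Ne.symm) hij hj hi
      exact ⟨v, h2, h1, h3⟩
  · rcases le_total i j with hij | hij
    · exact hL.meet_other_page hR hR' hb hij hi hj
    · obtain ⟨v, h1, h2, h3⟩ := hL.meet_other_page hR' hR (Ne.symm hb) hij hj hi
      exact ⟨v, h2, h1, h3⟩

/-- An edge passes through no vertices but its ends. -/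
lemma IsValid.vertex_on (hL : L.IsValid R) {b : Bool} {t h w : V} (hR : R b t h) {i : Fin 4}
    (hi : L.OnSeg b t h (L.X w) (L.Y w) i) : w = t ∨ w = h := by
  have b1 := hL.lo_le w
  have b2 := hL.le_hi w
  fin_cases i
  · exact Or.inl (hL.X_injective hi.1)
  · have := hL.lt_height hR w
    rw [← hi.1, sub_self, mul_zero] at this
    exact absurd this (lt_irrefl _)
  · obtain ⟨b3, b4⟩ := hL.onSeg_two_box hR hi
    exact Or.inr (hL.eq_of_mem_box b1 b2 b3 b4)
  · obtain ⟨b3, b4⟩ := hL.onSeg_three_box hR hi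
    exact Or.inr (hL.eq_of_mem_box b1 b2 b3 b4)

lemma IsValid.arc_isSimple (hL : L.IsValid R) (hφ : IsFrame φ) {b : Bool} {t h : V}
    (hR : R b t h) : (L.arc φ b t h).IsSimple := by
  have s1 := hL.slot_lt hR
  have s2 := hL.lt_slot hR
  have k1 := hL.lt_height hR t
  have k2 := hL.lt_height' hR hR
  have h5 : (sg b : ℝ) * sg b = 1 := by rcases sg_cases b with h | h <;> rw [h] <;> norm_num
  constructor
  · intro (i : Fin 4)
    fin_cases i <;> intro he
    · have e := (hφ.injective (show φ _ _ = φ _ _ from he)).2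
      rw [e, sub_self, mul_zero] at k1
      exact lt_irrefl _ k1
    · have e := (hφ.injective (show φ _ _ = φ _ _ from he)).1
      rw [e, sub_self, mul_zero] at s2
      exact lt_irrefl _ s2
    · have e := (hφ.injective (show φ _ _ = φ _ _ from he)).2
      rw [e, add_sub_cancel_left, h5] at k2
      exact lt_irrefl _ k2
    · have e := (hφ.injective (show φ _ _ = φ _ _ from he)).1
      rw [e, sub_self, mul_zero] at s1
      exact lt_irrefl _ s1
  · have key : ∀ (x y : ℝ) (i j : Fin 4), i < j → L.OnSeg b t h x y i → L.OnSeg b t h x y j →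
        (i : ℕ) + 1 = j ∧ φ x y = (L.arc φ b t h).pt (Fin.castSucc (n := 4) j) := by
      intro x y i j hij hi hj
      fin_cases i <;> fin_cases j <;>
        first
        | exact absurd hij (by decide)
        | skip
      · refine ⟨rfl, ?_⟩
        rw [hi.1, hj.1]
        rfl
      · exfalso
        obtain ⟨b3, b4⟩ := hL.onSeg_two_box hR hj
        exact hL.ne hR (hL.onSeg_zero_box hi b3 b4)
      · exfalso
        obtain ⟨b3, b4⟩ := hL.onSeg_three_box hR hj
        exact hL.ne hR (hL.onSeg_zero_box hi b3 b4)
      · refine ⟨rfl, ?_⟩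
        rw [hi.1, hj.1]
        rfl
      · exfalso
        obtain ⟨-, -, -, c1, -⟩ := hj
        rw [hi.1] at c1
        linarith
      · refine ⟨rfl, ?_⟩
        obtain ⟨a1, a2, -⟩ := hi
        obtain ⟨-, -, -, c1, -⟩ := hj
        have e : y = L.Y h + sg b := by
          have := le_antisymm c1 a2
          linear_combination (sg b : ℝ) * this + (L.Y h - y) * h5
        rw [a1, e]
        rfl
    intro (i : Fin 4) (j : Fin 4) hij z ⟨hzi, hzj⟩
    obtain ⟨x, y, rfl, hi⟩ := hL.exists_onSeg hφ hR hzi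
    obtain ⟨x', y', hxy, hj⟩ := hL.exists_onSeg hφ hR hzj
    obtain ⟨rfl, rfl⟩ := hφ.injective hxy
    exact key x y i j hij hi hj

end Layout
end RacSim

/-! ### Pairs of layouts with right-angled crossings -/

namespace RacSim

namespace Layout

variable {V : Type*} {G : SimpleGraph V} {L : Layout V} {R : Bool → V → V → Prop}
  {φ : ℝ → ℝ → Plane} {p : V → Plane}

/-- The drawing of a graph that is given by a layout, where `rep e` consists of the page, the tail
and the head of the edge `e`. -/
def drawing (L : Layout V) (φ : ℝ → ℝ → Plane) (hp : ∀ v, p v = φ (L.X v) (L.Y v))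
    (rep : G.edgeSet → Bool × V × V)
    (hrep : ∀ e : G.edgeSet, (e : Sym2 V) = s((rep e).2.1, (rep e).2.2)) :
    PolylineDrawing G p where
  edge e := L.arc φ (rep e).1 (rep e).2.1 (rep e).2.2
  ends e := by
    rw [hrep, Sym2.map_mk, hp, hp]
    rfl

lemma IsValid.drawing_isPlanar (hL : L.IsValid R) (hφ : IsFrame φ)
    (hp : ∀ v, p v = φ (L.X v) (L.Y v)) {rep : G.edgeSet → Bool × V × V}
    (hrep : ∀ e : G.edgeSet, (e : Sym2 V) = s((rep e).2.1, (rep e).2.2))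
    (hR : ∀ e, R (rep e).1 (rep e).2.1 (rep e).2.2) : (L.drawing φ hp rep hrep).IsPlanar where
  injective v w h := by
    rw [hp, hp] at h
    exact hL.X_injective (hφ.injective h).1
  simple e := hL.arc_isSimple hφ (hR e)
  vertex e w hw := by
    obtain ⟨i, hi⟩ := Set.mem_iUnion.1 hw
    obtain ⟨x, y, hxy, hi⟩ := hL.exists_onSeg hφ (hR e) hi
    rw [hp] at hxy
    obtain ⟨rfl, rfl⟩ := hφ.injective hxy
    rw [hrep, Sym2.mem_iff]
    exact hL.vertex_on (hR e) hi
  disjoint e f hef z hz := by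
    obtain ⟨i, hi⟩ := Set.mem_iUnion.1 hz.1
    obtain ⟨j, hj⟩ := Set.mem_iUnion.1 hz.2
    obtain ⟨x, y, rfl, hi'⟩ := hL.exists_onSeg hφ (hR e) hi
    obtain ⟨x', y', hxy, hj'⟩ := hL.exists_onSeg hφ (hR f) hj
    obtain ⟨rfl, rfl⟩ := hφ.injective hxy
    have hne : (rep e).1 ≠ (rep f).1 ∨ (rep e).2.1 ≠ (rep f).2.1 ∨
        (rep e).2.2 ≠ (rep f).2.2 := by
      by_contra hcon
      push Not at hcon
      exact hef (Subtype.ext (by rw [hrep e, hrep f, hcon.2.1, hcon.2.2]))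
    obtain ⟨v, h1, h2, rfl, rfl⟩ := hL.meet (hR e) (hR f) hne hi' hj'
    refine ⟨v, ?_, ?_, (hp v).symm⟩
    · rw [hrep, Sym2.mem_iff]
      exact h1
    · rw [hrep, Sym2.mem_iff]
      exact h2

/-- The standard coordinates. -/
noncomputable def frame₁ (x y : ℝ) : Plane := !₂[x, y]

/-- The coordinates `x' = C - y` and `y' = x`: the standard ones turned by a quarter, so that what
is vertical in one frame is horizontal in the other. -/
noncomputable def frame₂ (C x y : ℝ) : Plane := !₂[y, C - x]

lemma isFrame_frame₁ : IsFrame frame₁ where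
  injective {x y x' y'} h := by
    have h0 := congrFun (congrArg WithLp.ofLp h) 0
    have h1 := congrFun (congrArg WithLp.ofLp h) 1
    simp [frame₁] at h0 h1
    exact ⟨h0, h1⟩
  affine {a b} _ x y x' y' := by
    ext k
    fin_cases k <;> simp [frame₁]

lemma isFrame_frame₂ (C : ℝ) : IsFrame (frame₂ C) where
  injective {x y x' y'} h := by
    have h0 := congrFun (congrArg WithLp.ofLp h) 0
    have h1 := congrFun (congrArg WithLp.ofLp h) 1
    simp [frame₂] at h0 h1
    exact ⟨h1, h0⟩
  affine {a b} hab x y x' y' := by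
    obtain rfl : a = 1 - b := by linarith
    ext k
    fin_cases k <;> simp [frame₂]
    ring

lemma frame₁_eq_frame₂_iff {C x y x' y' : ℝ} :
    frame₁ x y = frame₂ C x' y' ↔ x' = C - y ∧ y' = x := by
  constructor
  · intro h
    have h0 := congrFun (congrArg WithLp.ofLp h) 0
    have h1 := congrFun (congrArg WithLp.ofLp h) 1
    simp [frame₁, frame₂] at h0 h1
    exact ⟨by linarith, h0.symm⟩
  · rintro ⟨rfl, rfl⟩
    simp [frame₁, frame₂]

/-- The conditions under which two valid layouts, the first one read in the standard coordinates and
the second one in the turned ones, yield a RAC simultaneous drawing: the vertices agree; the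
horizontal segments of each layout run outside of the part of the plane occupied by the other one;
and the slanted segments of each layout stay within the rows that the other one reserves for their
heads. -/
structure IsCompatible (L₁ : Layout V) (R₁ : Bool → V → V → Prop) (L₂ : Layout V)
    (R₂ : Bool → V → V → Prop) (C : ℝ) : Prop where
  X₂ : ∀ v, L₂.X v = C - L₁.Y v
  Y₂ : ∀ v, L₂.Y v = L₁.X v
  height₁ : ∀ {b t h}, R₁ b t h → ∀ v, 0 < sg b * (L₁.height b t h - C + L₂.lo v) ∧
    0 < sg b * (L₁.height b t h - C + L₂.hi v)
  height₂ : ∀ {b t h}, R₂ b t h → ∀ v, 0 < sg b * (L₂.height b t h - L₁.lo v) ∧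
    0 < sg b * (L₂.height b t h - L₁.hi v)
  box₁ : ∀ {b t h}, R₁ b t h → L₂.lo h ≤ L₂.X h - sg b ∧ L₂.X h - sg b ≤ L₂.hi h
  box₂ : ∀ {b t h}, R₂ b t h → L₁.lo h ≤ L₁.X h + sg b ∧ L₁.X h + sg b ≤ L₁.hi h

/-- The edges stay within the columns reserved for the vertices. -/
lemma IsValid.exists_box (hL : L.IsValid R) {b : Bool} {t h : V} (hR : R b t h) {x y : ℝ}
    {i : Fin 4} (hi : L.OnSeg b t h x y i) : ∃ v w, L.lo v ≤ x ∧ x ≤ L.hi w := by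
  fin_cases i
  · exact ⟨t, t, hi.1 ▸ hL.lo_le t, hi.1 ▸ hL.le_hi t⟩
  · obtain ⟨-, h1, h2⟩ := hi
    have h3 := hL.lo_le t
    have h4 := hL.le_hi t
    have h5 := hL.lo_le_slot hR
    have h6 := hL.slot_le_hi hR
    rcases sg_cases b with hb | hb <;> rw [hb] at h1 h2
    · exact ⟨t, h, by linarith, by linarith⟩
    · exact ⟨h, t, by linarith, by linarith⟩
  · exact ⟨h, h, hL.onSeg_two_box hR hi⟩
  · exact ⟨h, h, hL.onSeg_three_box hR hi⟩

variable {L₁ L₂ : Layout V} {R₁ R₂ : Bool → V → V → Prop} {C : ℝ}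

/-- Segments of edges of the two drawings meet either in vertices or at right angles. -/
lemma IsCompatible.cross (hc : L₁.IsCompatible R₁ L₂ R₂ C) (h₁ : L₁.IsValid R₁)
    (h₂ : L₂.IsValid R₂) {b b' : Bool} {t h t' h' : V} (hR₁ : R₁ b t h) (hR₂ : R₂ b' t' h')
    {x y : ℝ} {i j : Fin 4} (hi : L₁.OnSeg b t h x y i) (hj : L₂.OnSeg b' t' h' (C - y) x j) :
    ((i = 0 ∨ i = 2) ∧ (j = 0 ∨ j = 2)) ∨
      (x = L₁.X (if i = 0 then t else h) ∧ y = L₁.Y (if i = 0 then t else h)) := by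
  have hi1 : i ≠ 1 := by
    rintro rfl
    obtain ⟨v, w, hv, hw⟩ := h₂.exists_box hR₂ hj
    rw [hi.1] at hv hw
    have k1 := (hc.height₁ hR₁ v).1
    have k2 := (hc.height₁ hR₁ w).2
    rcases sg_cases b with hb | hb <;> rw [hb] at k1 k2 <;> linarith
  have hj1 : j ≠ 1 := by
    rintro rfl
    obtain ⟨v, w, hv, hw⟩ := h₁.exists_box hR₁ hi
    rw [hj.1] at hv hw
    have k1 := (hc.height₂ hR₂ v).1
    have k2 := (hc.height₂ hR₂ w).2
    rcases sg_cases b' with hb | hb <;> rw [hb] at k1 k2 <;> linarith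
  -- the slanted segments stay within the rows of their heads
  have row₁ : L₁.OnSeg b t h x y 3 → L₂.lo h ≤ C - y ∧ C - y ≤ L₂.hi h := by
    rintro ⟨-, -, a1, a2, -⟩
    obtain ⟨b1, b2⟩ := hc.box₁ hR₁
    have b3 := h₂.lo_le h
    have b4 := h₂.le_hi h
    rw [hc.X₂] at b1 b2 b3 b4
    rcases sg_cases b with hb | hb <;> rw [hb] at a1 a2 b1 b2 <;> constructor <;> linarith
  have row₂ : L₂.OnSeg b' t' h' (C - y) x 3 → L₁.lo h' ≤ x ∧ x ≤ L₁.hi h' := by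
    rintro ⟨-, -, a1, a2, -⟩
    obtain ⟨b1, b2⟩ := hc.box₂ hR₂
    have b3 := h₁.lo_le h'
    have b4 := h₁.le_hi h'
    rw [hc.Y₂] at a1 a2
    rcases sg_cases b' with hb | hb <;> rw [hb] at a1 a2 b1 b2 <;> constructor <;> linarith
  by_cases hi3 : i = 3
  · subst hi3
    right
    simp only [Fin.reduceEq, if_false]
    obtain ⟨r1, r2⟩ := row₁ hi
    by_cases hj0 : j = 0
    · subst hj0
      obtain rfl := h₂.onSeg_zero_box hj r1 r2
      have e : y = L₁.Y t' := by
        have e1 := hj.1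
        rw [hc.X₂] at e1
        linarith
      exact ⟨onSeg_three_eq_of_y hi e, e⟩
    by_cases hj2 : j = 2
    · exfalso
      subst hj2
      obtain ⟨r3, r4⟩ := h₂.onSeg_two_box hR₂ hj
      obtain rfl := h₂.eq_of_mem_box r1 r2 r3 r4
      obtain ⟨a1, a2, a3, a4, a5⟩ := hi
      obtain ⟨c1, c2, c3⟩ := hj
      have k := h₂.slot_lt hR₂
      rw [← c1, hc.X₂] at k
      rw [hc.Y₂] at c2
      rcases sg_cases b with hb | hb <;> rcases sg_cases b' with hb' | hb' <;>
        rw [hb] at a2 a3 <;> rw [hb'] at k c2 <;> linarith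
    obtain rfl : j = 3 := by
      fin_cases j <;> simp_all
    obtain ⟨r3, r4⟩ := row₂ hj
    obtain ⟨r5, r6⟩ := h₁.onSeg_three_box hR₁ hi
    obtain rfl := h₁.eq_of_mem_box r5 r6 r3 r4
    obtain ⟨a1, a2, a3, a4, a5⟩ := id hi
    obtain ⟨c1, c2, c3, c4, c5⟩ := hj
    rw [hc.X₂] at c2
    rw [hc.Y₂] at c3
    have hor : x = L₁.X h ∨ y = L₁.Y h := by
      rcases sg_cases b with hb | hb <;> rcases sg_cases b' with hb' | hb' <;>
        rw [hb] at a2 a3 <;> rw [hb'] at c2 c3 <;>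
        first
        | exact Or.inl (by linarith)
        | exact Or.inr (by linarith)
    rcases hor with e | e
    · exact ⟨e, h₁.onSeg_three_eq_of_x hR₁ hi e⟩
    · exact ⟨onSeg_three_eq_of_y hi e, e⟩
  have hi02 : i = 0 ∨ i = 2 := by
    fin_cases i <;> simp_all
  by_cases hj3 : j = 3
  · subst hj3
    right
    obtain ⟨r1, r2⟩ := row₂ hj
    rcases hi02 with rfl | rfl
    · obtain rfl := h₁.onSeg_zero_box hi r1 r2
      have e : x = L₁.X t := hi.1
      have e2 := onSeg_three_eq_of_y hj (by rw [hc.Y₂]; exact e)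
      rw [hc.X₂] at e2
      simp only [if_true]
      exact ⟨e, by linarith⟩
    · exfalso
      obtain ⟨r3, r4⟩ := h₁.onSeg_two_box hR₁ hi
      obtain rfl := h₁.eq_of_mem_box r1 r2 r3 r4
      obtain ⟨a1, a2, a3⟩ := hi
      obtain ⟨c1, c2, c3, c4, c5⟩ := hj
      have k := h₁.slot_lt hR₁
      rw [← a1] at k
      rw [hc.X₂] at c2
      rw [hc.Y₂] at c3
      rcases sg_cases b with hb | hb <;> rcases sg_cases b' with hb' | hb' <;>
        rw [hb] at a2 k <;> rw [hb'] at c2 c3 <;> linarith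
  · left
    refine ⟨hi02, ?_⟩
    fin_cases j <;> simp_all

theorem IsCompatible.isRacSim {G₁ G₂ : SimpleGraph V} (hc : L₁.IsCompatible R₁ L₂ R₂ C)
    (h₁ : L₁.IsValid R₁) (h₂ : L₂.IsValid R₂)
    (hp₁ : ∀ v, p v = frame₁ (L₁.X v) (L₁.Y v)) (hp₂ : ∀ v, p v = frame₂ C (L₂.X v) (L₂.Y v))
    {rep₁ : G₁.edgeSet → Bool × V × V} {rep₂ : G₂.edgeSet → Bool × V × V}
    (hrep₁ : ∀ e : G₁.edgeSet, (e : Sym2 V) = s((rep₁ e).2.1, (rep₁ e).2.2))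
    (hrep₂ : ∀ e : G₂.edgeSet, (e : Sym2 V) = s((rep₂ e).2.1, (rep₂ e).2.2))
    (hR₁ : ∀ e, R₁ (rep₁ e).1 (rep₁ e).2.1 (rep₁ e).2.2)
    (hR₂ : ∀ e, R₂ (rep₂ e).1 (rep₂ e).2.1 (rep₂ e).2.2) :
    IsRacSim (L₁.drawing frame₁ hp₁ rep₁ hrep₁) (L₂.drawing (frame₂ C) hp₂ rep₂ hrep₂) := by
  have key : ∀ (e : G₁.edgeSet) (f : G₂.edgeSet) (i j : Fin 4),
      ∀ z ∈ (L₁.arc frame₁ (rep₁ e).1 (rep₁ e).2.1 (rep₁ e).2.2).seg i ∩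
        (L₂.arc (frame₂ C) (rep₂ f).1 (rep₂ f).2.1 (rep₂ f).2.2).seg j,
      ∃ x y, z = frame₁ x y ∧ L₁.OnSeg (rep₁ e).1 (rep₁ e).2.1 (rep₁ e).2.2 x y i ∧
        L₂.OnSeg (rep₂ f).1 (rep₂ f).2.1 (rep₂ f).2.2 (C - y) x j := by
    rintro e f i j z ⟨hz₁, hz₂⟩
    obtain ⟨x, y, rfl, hi⟩ := h₁.exists_onSeg isFrame_frame₁ (hR₁ e) hz₁
    obtain ⟨x', y', hxy, hj⟩ := h₂.exists_onSeg (isFrame_frame₂ C) (hR₂ f) hz₂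
    obtain ⟨rfl, rfl⟩ := frame₁_eq_frame₂_iff.1 hxy
    exact ⟨_, _, rfl, hi, hj⟩
  refine ⟨h₁.drawing_isPlanar isFrame_frame₁ hp₁ hrep₁ hR₁,
    h₂.drawing_isPlanar (isFrame_frame₂ C) hp₂ hrep₂ hR₂, ?_, ?_⟩
  · intro e f (i : Fin 4) (j : Fin 4) z hz z' hz'
    obtain ⟨x, y, rfl, hi, hj⟩ := key e f i j z hz
    obtain ⟨x', y', rfl, hi', hj'⟩ := key e f i j z' hz'
    rcases hc.cross h₁ h₂ (hR₁ e) (hR₂ f) hi hj with hij | ⟨rfl, rfl⟩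
    · obtain ⟨rfl | rfl, rfl | rfl⟩ := hij <;>
      · have e1 := hi.1.trans hi'.1.symm
        have e2 := hj.1.trans hj'.1.symm
        rw [e1, show y = y' by linarith]
    · rcases hc.cross h₁ h₂ (hR₁ e) (hR₂ f) hi' hj' with hij | ⟨rfl, rfl⟩
      · obtain ⟨rfl | rfl, rfl | rfl⟩ := hij <;>
        · have e1 := hi.1.trans hi'.1.symm
          have e2 := hj.1.trans hj'.1.symm
          rw [← e1]
          congr 1
          linarith
      · rfl
  · intro e f (i : Fin 4) (j : Fin 4) z hz hzp
    obtain ⟨x, y, rfl, hi, hj⟩ := key e f i j z hz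
    rcases hc.cross h₁ h₂ (hR₁ e) (hR₂ f) hi hj with hij | ⟨rfl, rfl⟩
    · have d₁ : ∀ a c c' : ℝ, ∃ r, frame₁ a c - frame₁ a c' = !₂[0, r] := fun a c c' =>
        ⟨c - c', by ext k; fin_cases k <;> simp [frame₁]⟩
      have d₂ : ∀ a c c' : ℝ, ∃ r, frame₂ C a c - frame₂ C a c' = !₂[r, 0] := fun a c c' =>
        ⟨c - c', by ext k; fin_cases k <;> simp [frame₂]⟩
      have hd : ∀ r s : ℝ, inner ℝ (!₂[0, r] : Plane) !₂[s, 0] = 0 := fun r s => by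
        simp [PiLp.inner_apply, Fin.sum_univ_two]
      have e₁ : ∃ r, (L₁.arc frame₁ (rep₁ e).1 (rep₁ e).2.1 (rep₁ e).2.2).dir i = !₂[0, r] := by
        rcases hij.1 with rfl | rfl
        · exact d₁ _ _ _
        · exact d₁ _ _ _
      have e₂ : ∃ r, (L₂.arc (frame₂ C) (rep₂ f).1 (rep₂ f).2.1 (rep₂ f).2.2).dir j =
          !₂[r, 0] := by
        rcases hij.2 with rfl | rfl
        · exact d₂ _ _ _
        · exact d₂ _ _ _
      obtain ⟨r, hr⟩ := e₁
      obtain ⟨s, hs⟩ := e₂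
      exact (congrArg₂ (inner ℝ) hr hs).trans (hd r s)
    · exact absurd ⟨_, hp₁ _⟩ hzp

end Layout
end RacSim

/-! ### The edges of a book on two pages -/

namespace RacSim

variable {V : Type*}

/-- `f` numbers the vertices by `0, …, n - 1` such that no two edges of `G` cross when the vertices
are placed in this order on a line and the edges are drawn on one side of it. -/
structure IsBook [Fintype V] (G : SimpleGraph V) (f : V → ℕ) : Prop where
  injective : Function.Injective f
  lt_card : ∀ v, f v < Fintype.card V
  not_crossing : ∀ {a b c d}, G.Adj a b → G.Adj c d → f a < f c → f c < f b → f b < f d → False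

lemma IsBookOrder.exists_isBook [Fintype V] {G : SimpleGraph V} {f : V → ℤ}
    (h : IsBookOrder G Set.univ f) :
    ∃ g : V → ℕ, IsBook G g ∧ ∀ x y, g x < g y ↔ f x < f y := by
  classical
  have key : ∀ x y, f x < f y →
      (Finset.univ.filter (fun w => f w < f x)).card <
        (Finset.univ.filter (fun w => f w < f y)).card := by
    intro x y hxy
    refine Finset.card_lt_card (Finset.ssubset_iff_of_subset ?_ |>.2 ⟨x, ?_, ?_⟩)
    · intro w hw
      simp only [Finset.mem_filter, Finset.mem_univ, true_and] at hw ⊢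
      exact hw.trans hxy
    · simpa using hxy
    · simp
  have hiff : ∀ x y, (Finset.univ.filter (fun w => f w < f x)).card <
        (Finset.univ.filter (fun w => f w < f y)).card ↔ f x < f y := by
    refine fun x y => ⟨fun hlt => ?_, key x y⟩
    by_contra hcon
    rcases (not_lt.1 hcon).lt_or_eq with h1 | h1
    · exact absurd (key _ _ h1) (by omega)
    · rw [h1] at hlt
      exact lt_irrefl _ hlt
  refine ⟨fun x => (Finset.univ.filter (fun w => f w < f x)).card, ⟨?_, ?_, ?_⟩, hiff⟩
  · intro x y hxy
    apply h.injOn (Set.mem_univ x) (Set.mem_univ y)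
    by_contra hne
    rcases lt_or_gt_of_ne hne with h1 | h1
    · exact absurd (key _ _ h1) (by simp only at hxy; omega)
    · exact absurd (key _ _ h1) (by simp only at hxy; omega)
  · intro v
    rw [← Finset.card_univ]
    refine Finset.card_lt_card (Finset.ssubset_univ_iff.2 fun hv => ?_)
    have := Finset.mem_univ v
    rw [← hv] at this
    simp at this
  · intro a b c d hab hcd h1 h2 h3
    exact h.not_crossing a trivial b trivial c trivial d trivial hab hcd ((hiff _ _).1 h1)
      ((hiff _ _).1 h2) ((hiff _ _).1 h3)

/-- A book order can be turned and reflected such that a given vertex comes first and another given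
one does not come last. -/
lemma IsBookOrder.exists_first_not_last [Finite V] {G : SimpleGraph V} {f : V → ℤ}
    (h : IsBookOrder G Set.univ f) {z a c : V} (haz : a ≠ z) (hca : c ≠ a) (hcz : c ≠ z) :
    ∃ g, IsBookOrder G Set.univ g ∧ (∀ x, g z ≤ g x) ∧ ∃ x, g a < g x := by
  obtain ⟨g, hg, hz⟩ := h.exists_first Set.finite_univ (Set.mem_univ z)
  by_cases ha : ∃ x, g a < g x
  · exact ⟨g, hg, fun x => hz x trivial, ha⟩
  · push Not at ha
    have hlt : ∀ {x y}, x ≠ y → g x ≤ g y → g x < g y := fun hne hle =>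
      lt_of_le_of_ne hle fun he => hne (hg.injOn (Set.mem_univ _) (Set.mem_univ _) he)
    obtain ⟨M, hM⟩ := IsBookOrder.exists_bound Set.finite_univ (fun x => -g x)
    -- After the reflection `z` is last and `a` is first; turning moves `z` to the front again.
    refine ⟨_, hg.neg.rotate hM (-g z - 1), fun x => ?_, c, ?_⟩
    · have h1 := hM z trivial x trivial
      have h2 := hM x trivial z trivial
      have h3 := hz x trivial
      split_ifs <;> omega
    · have h1 := hlt haz.symm (hz a trivial)
      have h2 := hlt hcz.symm (hz c trivial)
      have h3 := hlt hca (ha c)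
      split_ifs <;> omega

/-- The oriented edges of the two pages. An edge from `u` to a later vertex `v` has tail `u` and is
on the upper page if `v` is the last neighbour of `u`; otherwise it has tail `v` and is on the lower
page. -/
def IsArc (G : SimpleGraph V) (f : V → ℕ) : Bool → V → V → Prop
  | true, t, h => G.Adj t h ∧ f t < f h ∧ ∀ w, G.Adj t w → f w ≤ f h
  | false, t, h => G.Adj t h ∧ f h < f t ∧ ∃ w, G.Adj h w ∧ f t < f w

namespace IsArc

variable {G : SimpleGraph V} {f : V → ℕ} {b : Bool} {t h t' h' : V}

lemma adj (ha : IsArc G f b t h) : G.Adj t h := by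
  cases b <;> exact ha.1

lemma lt (ha : IsArc G f b t h) : sg b * f t < sg b * f h := by
  cases b <;> have := ha.2.1 <;> simp only [sg] <;> omega

end IsArc

lemma exists_isArc {G : SimpleGraph V} {f : V → ℕ} (hf : Function.Injective f) {u v : V}
    (h : G.Adj u v) :
    ∃ q : Bool × V × V, IsArc G f q.1 q.2.1 q.2.2 ∧ s(u, v) = s(q.2.1, q.2.2) := by
  wlog huv : f u < f v generalizing u v
  · have h1 : f u ≠ f v := fun he => h.ne (hf he)
    rw [Sym2.eq_swap]
    exact this h.symm (by omega)
  by_cases hw : ∃ w, G.Adj u w ∧ f v < f w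
  · exact ⟨(false, v, u), ⟨h.symm, huv, hw⟩, Sym2.eq_swap⟩
  · push Not at hw
    exact ⟨(true, u, v), ⟨h, huv, hw⟩, rfl⟩

namespace IsBook

variable [Fintype V] {G : SimpleGraph V} {f : V → ℕ} {b : Bool} {t h t' h' : V}

/-- Every vertex is the tail of at most one edge on each page. -/
lemma head_unique (hf : IsBook G f) (h₁ : IsArc G f b t h) (h₂ : IsArc G f b t h') : h = h' := by
  apply hf.injective
  cases b
  · obtain ⟨h1, h2, w, h3, h4⟩ := h₁
    obtain ⟨h1', h2', w', h3', h4'⟩ := h₂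
    by_contra hne
    rcases lt_or_gt_of_ne hne with hlt | hlt
    · exact hf.not_crossing h1.symm h3' hlt h2' h4'
    · exact hf.not_crossing h1'.symm h3 hlt h2 h4
  · exact le_antisymm (h₂.2.2 _ h₁.1) (h₁.2.2 _ h₂.1)

lemma nested (hf : IsBook G f) (h₁ : IsArc G f b t h) (h₂ : IsArc G f b t' h')
    (hlt : sg b * f t < sg b * f t') (hlt' : sg b * f t' < sg b * f h) :
    sg b * f h' ≤ sg b * f h := by
  by_contra hcon
  cases b <;> simp only [sg] at *
  · exact hf.not_crossing h₂.adj.symm h₁.adj.symm (by omega) (by omega) (by omega)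
  · exact hf.not_crossing h₁.adj h₂.adj (by omega) (by omega) (by omega)

lemma exists_eq (hf : IsBook G f) {k : ℕ} (hk : k < Fintype.card V) : ∃ v, f v = k := by
  have hb : Function.Bijective (fun v => (⟨f v, hf.lt_card v⟩ : Fin (Fintype.card V))) :=
    (Fintype.bijective_iff_injective_and_card _).2
      ⟨fun x y hxy => hf.injective (Fin.mk.inj hxy), by simp⟩
  obtain ⟨v, hv⟩ := hb.2 ⟨k, hk⟩
  exact ⟨v, Fin.mk.inj hv⟩

end IsBook

end RacSim

/-! ### The layout of a book -/

namespace RacSim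

variable {V : Type*} [Fintype V] {G : SimpleGraph V} {f : V → ℕ}

open Classical in
/-- The number of edges on page `b` with head `v`. -/
noncomputable def inDegree (G : SimpleGraph V) (f : V → ℕ) (b : Bool) (v : V) : ℕ :=
  (Finset.univ.filter fun t => IsArc G f b t v).card

open Classical in
/-- The position of the edge with tail `t` and head `h` among the edges on page `b` with head `h`,
where the one with the farthest tail is the first one. -/
noncomputable def arcRank (G : SimpleGraph V) (f : V → ℕ) (b : Bool) (t h : V) : ℕ :=
  (Finset.univ.filter fun t' => IsArc G f b t' h ∧ sg b * f t' ≤ sg b * f t).card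

lemma arcRank_le (b : Bool) (t h : V) : arcRank G f b t h ≤ inDegree G f b h := by
  classical
  exact Finset.card_le_card fun x hx => by
    simp only [Finset.mem_filter, Finset.mem_univ, true_and] at hx ⊢
    exact hx.1

lemma arcRank_pos {b : Bool} {t h : V} (ha : IsArc G f b t h) : 0 < arcRank G f b t h := by
  classical
  exact Finset.card_pos.2 ⟨t, by simpa using ha⟩

lemma inDegree_pos {b : Bool} {t h : V} (ha : IsArc G f b t h) : 0 < inDegree G f b h :=
  (arcRank_pos ha).trans_le (arcRank_le b t h)

lemma exists_isArc_of_inDegree_pos {b : Bool} {h : V} (hp : 0 < inDegree G f b h) :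
    ∃ t, IsArc G f b t h := by
  classical
  obtain ⟨t, ht⟩ := Finset.card_pos.1 hp
  exact ⟨t, by simpa using ht⟩

lemma arcRank_lt {b : Bool} {t t' h : V} (ha : IsArc G f b t' h)
    (hlt : sg b * f t < sg b * f t') : arcRank G f b t h < arcRank G f b t' h := by
  classical
  refine Finset.card_lt_card ((Finset.ssubset_iff_of_subset ?_).2 ⟨t', ?_, ?_⟩)
  · intro x hx
    simp only [Finset.mem_filter, Finset.mem_univ, true_and] at hx ⊢
    exact ⟨hx.1, hx.2.trans hlt.le⟩
  · simpa using ha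
  · simp only [Finset.mem_filter, Finset.mem_univ, true_and, not_and, not_le]
    exact fun _ => hlt

/-- The column of the vertex `v` if every vertex `u` has `w true u` further columns to its left and
`w false u` further columns to its right. -/
def column (f : V → ℕ) (w : Bool → V → ℕ) (v : V) : ℕ :=
  ∑ u with f u < f v, (w true u + 1 + w false u) + w true v

lemma column_add_le (w : Bool → V → ℕ) {u v : V} (h : f u < f v) :
    column f w u + w false u + 1 + w true v ≤ column f w v := by
  classical
  have h1 : insert u (Finset.univ.filter fun x => f x < f u) ⊆
      Finset.univ.filter fun x => f x < f v := by
    intro x hx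
    simp only [Finset.mem_insert, Finset.mem_filter, Finset.mem_univ, true_and] at hx ⊢
    rcases hx with rfl | hx <;> omega
  have h2 := Finset.sum_le_sum_of_subset (f := fun x => w true x + 1 + w false x) h1
  rw [Finset.sum_insert (by simp)] at h2
  unfold column
  omega

lemma column_add_lt (f : V → ℕ) (w : Bool → V → ℕ) (v : V) :
    column f w v + w false v < ∑ u, (w true u + 1 + w false u) := by
  classical
  have h2 := Finset.sum_le_sum_of_subset (f := fun x => w true x + 1 + w false x)
    (Finset.subset_univ (insert v (Finset.univ.filter fun x => f x < f v)))
  rw [Finset.sum_insert (by simp)] at h2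
  unfold column
  omega

lemma le_column (f : V → ℕ) (w : Bool → V → ℕ) (v : V) : w true v ≤ column f w v :=
  Nat.le_add_left _ _

/-- The layout of a book: the columns are counted from `x₀` on, the slots of the edges with head `v`
are next to `v`, and the row of an edge depends on the distance of its end vertices. -/
noncomputable def bookLayout (G : SimpleGraph V) (f : V → ℕ) (w : Bool → V → ℕ) (x₀ : ℤ)
    (Y : V → ℤ) (level : Bool → ℤ) : Layout V where
  X v := (x₀ + column f w v : ℤ)
  Y v := (Y v : ℤ)
  lo v := (x₀ + column f w v - w true v : ℤ)
  hi v := (x₀ + column f w v + w false v : ℤ)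
  slot b t h := (x₀ + column f w h - sg b * arcRank G f b t h : ℤ)
  height b t h := (level b + (f h - f t) : ℤ)

lemma bookLayout_isValid (hf : IsBook G f) {w : Bool → V → ℕ} (hw : ∀ b v, inDegree G f b v ≤ w b v)
    {x₀ : ℤ} {Y : V → ℤ} {level : Bool → ℤ} (hY : ∀ b v, 0 ≤ sg b * (level b - Y v))
    (hY' : ∀ b v, 0 < inDegree G f b v → 0 < sg b * (level b - Y v)) :
    (bookLayout G f w x₀ Y level).IsValid (IsArc G f) := by
  have hcol : ∀ {b : Bool} {u v : V}, sg b * f u < sg b * f v →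
      sg b * column f w u + 1 + w b v ≤ sg b * column f w v := by
    intro b u v h
    cases b <;> simp only [sg] at h ⊢
    · have := column_add_le w (show f v < f u by omega)
      omega
    · have := column_add_le w (show f u < f v by omega)
      omega
  have hrank : ∀ b t h, arcRank G f b t h ≤ w b h := fun b t h => (arcRank_le b t h).trans (hw b h)
  refine ⟨fun ha => ha.adj.ne, ?_, ?_, ?_, ?_, ?_, ?_, ?_, ?_, ?_, ?_⟩ <;>
    simp only [bookLayout]
  · intro v
    norm_cast
    omega
  · intro v
    norm_cast
    omega
  · intro u v huv
    norm_cast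
    rcases lt_or_gt_of_ne fun h => huv (hf.injective h) with h | h
    · have := column_add_le w h
      omega
    · have := column_add_le w h
      omega
  · intro b t h ha
    norm_cast
    have := hrank b t h
    cases b <;> simp only [sg] <;> omega
  · intro b t h ha
    norm_cast
    have := hrank b t h
    cases b <;> simp only [sg] <;> omega
  · intro b t h ha
    norm_cast
    have := arcRank_pos ha
    cases b <;> simp only [sg] <;> omega
  · intro b t h ha
    norm_cast
    have h1 := hrank b t h
    have h2 := hcol ha.lt
    cases b <;> simp only [sg] at h2 ⊢ <;> omega
  · intro b t h ha v
    norm_cast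
    simp only [Int.subNatNat_eq_coe]
    have h1 := hY b v
    have h2 := ha.lt
    cases b <;> simp only [sg] at h1 h2 ⊢ <;> omega
  · intro b t h t' h' ha ha'
    norm_cast
    simp only [Int.subNatNat_eq_coe]
    have h1 := hY' b h' (inDegree_pos ha')
    have h2 := ha.lt
    cases b <;> simp only [sg] at h1 h2 ⊢ <;> omega
  · intro b t h t' h' ha ha' hne
    norm_cast
    simp only [Int.subNatNat_eq_coe]
    have htt : t ≠ t' := by
      rintro rfl
      exact hne.elim (fun h => h rfl) fun h => h (hf.head_unique ha ha')
    refine ⟨htt, ?_⟩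
    -- Two edges of a page are either apart or nested; nested ones have nested slots.
    have main : ∀ {t h t' h'}, IsArc G f b t h → IsArc G f b t' h' → sg b * f t < sg b * f t' →
        0 < sg b * (x₀ + column f w t' - (x₀ + column f w h - sg b * arcRank G f b t h)) ∨
        (0 < sg b * (x₀ + column f w t' - (x₀ + column f w t)) ∧
        0 < sg b * (x₀ + column f w h - sg b * arcRank G f b t h -
          (x₀ + column f w h' - sg b * arcRank G f b t' h')) ∧
        0 < sg b * (level b + ((f h : ℤ) - f t) - (level b + ((f h' : ℤ) - f t')))) := by
      intro t h t' h' ha ha' hlt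
      have r1 := arcRank_pos ha
      rcases le_or_gt (sg b * f h) (sg b * f t') with h1 | h1
      · left
        have h2 : sg b * column f w h ≤ sg b * column f w t' := by
          rcases h1.lt_or_eq with h2 | h2
          · have := hcol h2
            omega
          · have : f h = f t' := by cases b <;> simp only [sg] at h2 <;> omega
            rw [hf.injective this]
        cases b <;> simp only [sg] at h2 ⊢ <;> omega
      · right
        have h2 := hcol hlt
        have h3 := hf.nested ha ha' hlt h1
        have h4 : sg b * (column f w h' - sg b * arcRank G f b t' h') <
            sg b * (column f w h - sg b * arcRank G f b t h) := by
          rcases h3.lt_or_eq with h4 | h4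
          · have h5 := hcol h4
            have h6 := hrank b t h
            have h7 := arcRank_pos ha'
            cases b <;> simp only [sg] at h5 ⊢ <;> omega
          · have h5 : f h' = f h := by cases b <;> simp only [sg] at h4 <;> omega
            obtain rfl := hf.injective h5
            have h6 := arcRank_lt ha' hlt
            cases b <;> simp only [sg] <;> omega
        cases b <;> simp only [sg] at hlt h2 h3 h4 ⊢ <;> omega
    rcases lt_or_gt_of_ne fun h => htt (hf.injective h) with h1 | h1
    · cases b
      · rcases main ha' ha (by simp only [sg]; omega) with h2 | h2
        · exact Or.inr (Or.inl h2)
        · exact Or.inr (Or.inr (Or.inr h2))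
      · rcases main ha ha' (by simp only [sg]; omega) with h2 | h2
        · exact Or.inl h2
        · exact Or.inr (Or.inr (Or.inl h2))
    · cases b
      · rcases main ha ha' (by simp only [sg]; omega) with h2 | h2
        · exact Or.inl h2
        · exact Or.inr (Or.inr (Or.inl h2))
      · rcases main ha' ha (by simp only [sg]; omega) with h2 | h2
        · exact Or.inr (Or.inl h2)
        · exact Or.inr (Or.inr (Or.inr h2))

end RacSim

/-! ### Two books on a common vertex set -/

namespace RacSim

variable {V : Type*} [Fintype V] {G : SimpleGraph V} {f : V → ℕ}

lemma bookLayout_mem (hf : IsBook G f) {w : Bool → V → ℕ} (hw : ∀ b v, inDegree G f b v ≤ w b v)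
    {x₀ : ℤ} {Y : V → ℤ} {level : Bool → ℤ} (hY : ∀ b v, 0 ≤ sg b * (level b - Y v))
    (hY' : ∀ b v, 0 < inDegree G f b v → 0 < sg b * (level b - Y v)) {φ : ℝ → ℝ → Plane}
    {S : Set Plane} (hS : ∀ x y : ℤ, x₀ ≤ x → x < x₀ + ∑ u, (w true u + 1 + w false u : ℕ) →
      level false - (Fintype.card V - 2) ≤ y → y ≤ level true + (Fintype.card V - 1) → φ x y ∈ S)
    {b : Bool} {t h : V} (ha : IsArc G f b t h) (i : Fin 5) :
    ((bookLayout G f w x₀ Y level).arc φ b t h).pt i ∈ S := by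
  have hX : ∀ v, 0 ≤ (column f w v : ℤ) - w true v ∧
      (column f w v + w false v : ℤ) < ∑ u, (w true u + 1 + w false u : ℕ) := by
    intro v
    have h1 := le_column f w v
    have h2 := column_add_lt f w v
    constructor
    · omega
    · exact_mod_cast h2
  have hXt := hX t
  have hXh := hX h
  have hr : arcRank G f b t h ≤ w b h := (arcRank_le b t h).trans (hw b h)
  have y1 := hY true t
  have y2 := hY false t
  have y3 := hY true h
  have y4 := hY false h
  have y5 := hY' b h (inDegree_pos ha)
  have hc := hf.lt_card t
  have hc' := hf.lt_card h
  have hH : level false - (Fintype.card V - 2) ≤ level b + (f h - f t) ∧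
      level b + ((f h : ℤ) - f t) ≤ level true + (Fintype.card V - 1) := by
    cases b
    · obtain ⟨-, h1, z, -, h2⟩ := ha
      have h3 := hf.lt_card z
      simp only [sg] at *
      omega
    · have := ha.2.1
      simp only [sg] at *
      omega
  simp only [sg] at y1 y2 y3 y4
  have hs : x₀ ≤ x₀ + column f w h - sg b * arcRank G f b t h ∧
      x₀ + column f w h - sg b * arcRank G f b t h <
        x₀ + ∑ u, (w true u + 1 + w false u : ℕ) := by
    cases b <;> simp only [sg] <;> omega
  have hY1 : level false - (Fintype.card V - 2) ≤ Y h + sg b ∧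
      Y h + sg b ≤ level true + (Fintype.card V - 1) := by
    have h2 := ha.lt
    cases b <;> simp only [sg] at y5 h2 ⊢ <;> omega
  have h2 := ha.lt
  have hcard : (2 : ℤ) ≤ Fintype.card V := by
    cases b <;> simp only [sg] at h2 <;> omega
  fin_cases i
  · exact hS _ _ (by omega) (by omega) (by omega) (by omega)
  · exact hS _ _ (by omega) (by omega) hH.1 hH.2
  · exact hS _ _ hs.1 hs.2 hH.1 hH.2
  · have := hS _ _ hs.1 hs.2 hY1.1 hY1.2
    rw [Int.cast_add (Y h)] at this
    exact this
  · exact hS _ _ (by omega) (by omega) (by omega) (by omega)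

/-- Two books yield a RAC simultaneous drawing: the order of the first one gives the columns of
the vertices and that of the second one their rows. The numbers `w₁ b v` and `w₂ b v` of columns
and rows reserved next to `v` have to suffice for the slots of `v` in its own drawing, and for the
ends of the edges with head `v` in the other drawing. -/
lemma exists_isRacSim_of_isBook {G₁ G₂ : SimpleGraph V} {f₁ f₂ : V → ℕ} (hf₁ : IsBook G₁ f₁)
    (hf₂ : IsBook G₂ f₂) {w₁ w₂ : Bool → V → ℕ} (hw₁ : ∀ b v, inDegree G₁ f₁ b v ≤ w₁ b v)
    (hw₂ : ∀ b v, inDegree G₂ f₂ b v ≤ w₂ b v)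
    (hw₁' : ∀ b v, 0 < inDegree G₂ f₂ (!b) v → 0 < w₁ b v)
    (hw₂' : ∀ b v, 0 < inDegree G₁ f₁ b v → 0 < w₂ b v) {M : ℤ} (hn : 2 ≤ Fintype.card V)
    (hM₁ : (∑ v, (w₁ true v + 1 + w₁ false v) : ℕ) + 2 * (Fintype.card V : ℤ) - 3 ≤ M)
    (hM₂ : (∑ v, (w₂ true v + 1 + w₂ false v) : ℕ) + 2 * (Fintype.card V : ℤ) - 3 ≤ M) :
    ∃ (p : V → Plane) (D₁ : PolylineDrawing G₁ p) (D₂ : PolylineDrawing G₂ p),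
      IsRacSim D₁ D₂ ∧ D₁.OnGrid M M ∧ D₂.OnGrid M M ∧
      (∀ e, (D₁.edge e).bends ≤ 3) ∧ (∀ e, (D₂.edge e).bends ≤ 3) := by
  have hrep : ∀ {G : SimpleGraph V} {f : V → ℕ}, Function.Injective f → ∀ e : G.edgeSet,
      ∃ q : Bool × V × V, IsArc G f q.1 q.2.1 q.2.2 ∧ (e : Sym2 V) = s(q.2.1, q.2.2) := by
    intro G f hf e
    obtain ⟨e, he⟩ := e
    induction e with
    | _ u v => exact exists_isArc hf he
  choose rep₁ hR₁ hrep₁ using hrep (G := G₁) hf₁.injective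
  choose rep₂ hR₂ hrep₂ using hrep (G := G₂) hf₂.injective
  set n : ℤ := (Fintype.card V : ℤ) with hn'
  set W₁ : ℕ := ∑ v, (w₁ true v + 1 + w₁ false v) with hW₁
  set W₂ : ℕ := ∑ v, (w₂ true v + 1 + w₂ false v) with hW₂
  have hc₁ : ∀ v, w₁ true v ≤ column f₁ w₁ v ∧ column f₁ w₁ v + w₁ false v < W₁ :=
    fun v => ⟨le_column _ _ _, column_add_lt _ _ _⟩
  have hc₂ : ∀ v, w₂ true v ≤ column f₂ w₂ v ∧ column f₂ w₂ v + w₂ false v < W₂ :=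
    fun v => ⟨le_column _ _ _, column_add_lt _ _ _⟩
  -- The vertices and slots occupy a block of `W₁` columns and `W₂` rows. In either direction,
  -- `n - 2` lines on one side of the block house the far segments of the lower page, whose edges
  -- join vertices at distance at most `n - 2`, and `n - 1` lines on the other side those of the
  -- upper page.
  set C : ℤ := n + W₂ - 3 with hC
  let level₁ : Bool → ℤ := fun b => if b then C else n - 2
  let level₂ : Bool → ℤ := fun b => if b then n - 3 + W₁ else n - 2
  let Y₁ : V → ℤ := fun v => C - column f₂ w₂ v
  let Y₂ : V → ℤ := fun v => n - 2 + column f₁ w₁ v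
  have hY₁ : ∀ b v, 0 ≤ sg b * (level₁ b - Y₁ v) := by
    intro b v
    have := hc₂ v
    cases b <;> simp only [sg, level₁, Y₁, Bool.false_eq_true, if_true, if_false] <;> omega
  have hY₂ : ∀ b v, 0 ≤ sg b * (level₂ b - Y₂ v) := by
    intro b v
    have := hc₁ v
    cases b <;> simp only [sg, level₂, Y₂, Bool.false_eq_true, if_true, if_false] <;> omega
  have hY₁' : ∀ b v, 0 < inDegree G₁ f₁ b v → 0 < sg b * (level₁ b - Y₁ v) := by
    intro b v hp
    have := hc₂ v
    have := hw₂' b v hp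
    cases b <;> simp only [sg, level₁, Y₁, Bool.false_eq_true, if_true, if_false] <;> omega
  have hY₂' : ∀ b v, 0 < inDegree G₂ f₂ b v → 0 < sg b * (level₂ b - Y₂ v) := by
    intro b v hp
    have := hc₁ v
    have := hw₁' (!b) v (by rwa [Bool.not_not])
    cases b <;> simp [sg, level₂, Y₂] <;> simp at this <;> omega
  have hL₁ := bookLayout_isValid hf₁ hw₁ (x₀ := n - 2) hY₁ hY₁'
  have hL₂ := bookLayout_isValid hf₂ hw₂ (x₀ := 0) hY₂ hY₂'
  set L₁ := bookLayout G₁ f₁ w₁ (n - 2) Y₁ level₁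
  set L₂ := bookLayout G₂ f₂ w₂ 0 Y₂ level₂
  have hcomp : Layout.IsCompatible L₁ (IsArc G₁ f₁) L₂ (IsArc G₂ f₂) C := by
    refine ⟨fun v => ?_, fun v => ?_, fun {b t h} ha v => ?_, fun {b t h} ha v => ?_,
      fun {b t h} ha => ?_, fun {b t h} ha => ?_⟩ <;> simp only [L₁, L₂, bookLayout]
    · simp only [Y₁]
      push_cast
      ring
    · rfl
    · norm_cast
      simp only [Int.subNatNat_eq_coe]
      have h1 := hc₂ v
      have h2 := ha.lt
      cases b <;> simp only [sg, level₁, Bool.false_eq_true, if_true, if_false] at h2 ⊢ <;> omega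
    · norm_cast
      simp only [Int.subNatNat_eq_coe]
      have h1 := hc₁ v
      have h2 := ha.lt
      cases b <;> simp only [sg, level₂, Bool.false_eq_true, if_true, if_false] at h2 ⊢ <;> omega
    · norm_cast
      simp only [Int.subNatNat_eq_coe]
      have h1 := hw₂' b h (inDegree_pos ha)
      cases b <;> simp only [sg] <;> omega
    · norm_cast
      have h1 := hw₁' (!b) h (by rw [Bool.not_not]; exact inDegree_pos ha)
      cases b <;> simp only [sg, Bool.not_true, Bool.not_false] at h1 ⊢ <;> omega
  have hp : ∀ v, Layout.frame₁ (L₁.X v) (L₁.Y v) = Layout.frame₂ C (L₂.X v) (L₂.Y v) := fun v =>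
    Layout.frame₁_eq_frame₂_iff.2 ⟨hcomp.X₂ v, hcomp.Y₂ v⟩
  have hv : ∀ v, Layout.frame₁ (L₁.X v) (L₁.Y v) ∈ {z : Plane | ∃ x y : ℤ, 0 ≤ x ∧ x < M ∧
      0 ≤ y ∧ y < M ∧ z = !₂[(x : ℝ), (y : ℝ)]} := fun v => by
    have := hc₁ v
    have := hc₂ v
    have : Y₁ v = C - column f₂ w₂ v := rfl
    exact ⟨n - 2 + column f₁ w₁ v, Y₁ v, by omega, by omega, by omega, by omega, rfl⟩
  refine ⟨fun v => Layout.frame₁ (L₁.X v) (L₁.Y v),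
    L₁.drawing Layout.frame₁ (fun _ => rfl) rep₁ hrep₁,
    L₂.drawing (Layout.frame₂ C) hp rep₂ hrep₂,
    hcomp.isRacSim hL₁ hL₂ _ _ hrep₁ hrep₂ hR₁ hR₂, ⟨fun v => ?_, fun e i => ?_⟩,
    ⟨fun v => ?_, fun e i => ?_⟩, fun _ => le_rfl, fun _ => le_rfl⟩
  · exact hv v
  · refine bookLayout_mem hf₁ hw₁ hY₁ hY₁' (fun x y h1 h2 h3 h4 => ?_) (hR₁ e) i
    rw [← hW₁] at h2
    simp [level₁] at h3 h4
    exact ⟨x, y, by omega, by omega, by omega, by omega, rfl⟩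
  · exact hv v
  · refine bookLayout_mem hf₂ hw₂ hY₂ hY₂' (fun x y h1 h2 h3 h4 => ?_) (hR₂ e) i
    rw [← hW₂] at h2
    simp [level₂] at h3 h4
    refine ⟨y, C - x, by omega, by omega, by omega, by omega, ?_⟩
    simp only [Layout.frame₂, Int.cast_sub]

end RacSim

/-! ### The size of the grid -/

namespace RacSim

variable {V : Type*} [Fintype V] {G : SimpleGraph V} {f : V → ℕ}

lemma IsBook.sum_inDegree_le (hf : IsBook G f) (b : Bool) {S : Finset V}
    (hS : ∀ t h, IsArc G f b t h → t ∈ S) : ∑ v, inDegree G f b v ≤ S.card := by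
  classical
  simp only [inDegree, Finset.card_filter]
  rw [Finset.sum_comm, Finset.card_eq_sum_ones, ← Finset.sum_subset (Finset.subset_univ S)]
  · refine Finset.sum_le_sum fun t _ => ?_
    rw [← Finset.card_filter, Finset.card_le_one]
    intro x hx y hy
    simp only [Finset.mem_filter, Finset.mem_univ, true_and] at hx hy
    exact hf.head_unique hx hy
  · intro t _ ht
    exact Finset.sum_eq_zero fun h _ => if_neg fun ha => ht (hS t h ha)

lemma sum_max_le (A : V → ℕ) (P : V → Prop) [DecidablePred P] :
    ∑ v, max (A v) (if P v then 1 else 0) ≤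
      ∑ v, A v + (Finset.univ.filter fun v => P v ∧ A v = 0).card := by
  rw [Finset.card_filter, ← Finset.sum_add_distrib]
  refine Finset.sum_le_sum fun v _ => ?_
  by_cases h1 : P v <;> by_cases h2 : A v = 0 <;> simp [h1, h2]
  omega

lemma card_filter_add_one_le {P : V → Prop} [DecidablePred P] {x : V} (hx : ¬ P x) :
    (Finset.univ.filter P).card + 1 ≤ Fintype.card V := by
  classical
  rw [← Finset.card_insert_of_notMem (a := x) (by simpa using hx)]
  exact Finset.card_le_univ _

lemma card_filter_add_two_le {P : V → Prop} [DecidablePred P] {x y : V} (hxy : x ≠ y)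
    (hx : ¬ P x) (hy : ¬ P y) : (Finset.univ.filter P).card + 2 ≤ Fintype.card V := by
  classical
  rw [← Finset.card_univ, ← Finset.card_pair hxy, ← Finset.card_union_of_disjoint]
  · exact Finset.card_le_card (Finset.subset_univ _)
  · rw [Finset.disjoint_left]
    intro v hv hv'
    simp only [Finset.mem_insert, Finset.mem_singleton, Finset.mem_filter, Finset.mem_univ,
      true_and] at hv hv'
    rcases hv' with rfl | rfl
    · exact hx hv
    · exact hy hv

namespace IsBook

/-- The last vertex is not a tail on the upper page. -/
lemma sum_inDegree_true_le (hf : IsBook G f) {z : V} (hz : f z + 1 = Fintype.card V) :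
    ∑ v, inDegree G f true v + 1 ≤ Fintype.card V := by
  classical
  refine (add_le_add_left (hf.sum_inDegree_le true
    (S := Finset.univ.filter fun t => t ≠ z) fun t h ha => ?_) 1).trans
    (card_filter_add_one_le (x := z) (by simp))
  simp only [Finset.mem_filter, Finset.mem_univ, true_and]
  rintro rfl
  have := ha.2.1
  have := hf.lt_card h
  omega

/-- The first and the last vertex are not tails on the lower page. -/
lemma sum_inDegree_false_le (hf : IsBook G f) {a z : V} (ha : f a = 0)
    (hz : f z + 1 = Fintype.card V) (haz : a ≠ z) :
    ∑ v, inDegree G f false v + 2 ≤ Fintype.card V := by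
  classical
  refine (add_le_add_left (hf.sum_inDegree_le false
    (S := Finset.univ.filter fun t => t ≠ a ∧ t ≠ z) fun t h hth => ?_) 2).trans
    (card_filter_add_two_le haz (by simp) (by simp))
  simp only [Finset.mem_filter, Finset.mem_univ, true_and]
  obtain ⟨-, h1, w, -, h2⟩ := hth
  constructor
  · rintro rfl
    omega
  · rintro rfl
    have := hf.lt_card w
    omega

lemma inDegree_true_of_first {a : V} (ha : f a = 0) : ¬ 0 < inDegree G f true a := by
  intro h
  obtain ⟨t, ht⟩ := exists_isArc_of_inDegree_pos h
  have := ht.2.1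
  omega

/-- The last two vertices are not heads on the lower page. -/
lemma inDegree_false_of_last (hf : IsBook G f) {z : V} (hz : Fintype.card V ≤ f z + 2) :
    ¬ 0 < inDegree G f false z := by
  intro h
  obtain ⟨t, -, h1, w, -, h2⟩ := exists_isArc_of_inDegree_pos h
  have := hf.lt_card w
  omega

/-- If all vertices except the last one are tails on the upper page, then the last vertex is a
head there, namely of an edge from the last but one vertex. -/
lemma inDegree_true_of_last (hf : IsBook G f) {y : V} (hy : f y + 1 = Fintype.card V)
    (hn : 2 ≤ Fintype.card V) (hsum : Fintype.card V ≤ ∑ v, inDegree G f true v + 1) :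
    0 < inDegree G f true y := by
  classical
  by_contra hcon
  obtain ⟨x, hx⟩ := hf.exists_eq (show Fintype.card V - 2 < Fintype.card V by omega)
  have hxy : x ≠ y := by
    rintro rfl
    omega
  have h1 := hf.sum_inDegree_le true (S := Finset.univ.filter fun t => t ≠ x ∧ t ≠ y)
    fun t h ha => by
      simp only [Finset.mem_filter, Finset.mem_univ, true_and]
      obtain ⟨-, h1, -⟩ := id ha
      have h2 := hf.lt_card h
      constructor
      · rintro rfl
        obtain rfl : h = y := hf.injective (by omega)
        exact hcon (inDegree_pos ha)
      · rintro rfl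
        omega
  have h2 := card_filter_add_two_le hxy (P := fun t => t ≠ x ∧ t ≠ y) (by simp) (by simp)
  omega

end IsBook

open Classical in
/-- The numbers of columns to be reserved at the left (`true`) and at the right (`false`) of the
vertices if these columns have to house `A b v` slots, and at least one column whenever `P b v`. -/
noncomputable def reserve (A : Bool → V → ℕ) (P : Bool → V → Prop) (b : Bool) (v : V) : ℕ :=
  max (A b v) (if P b v then 1 else 0)

lemma exists_isRacSim_of_three_le {G₁ G₂ : SimpleGraph V} {f₁ f₂ : V → ℕ} (hf₁ : IsBook G₁ f₁)
    (hf₂ : IsBook G₂ f₂) (hn : 3 ≤ Fintype.card V) {a z y : V} (ha : f₁ a = 0)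
    (hz : f₁ z + 1 = Fintype.card V) (hz' : f₂ z = 0) (hy : f₂ y + 1 = Fintype.card V)
    (hya : y ≠ a) :
    ∃ (p : V → Plane) (D₁ : PolylineDrawing G₁ p) (D₂ : PolylineDrawing G₂ p),
      IsRacSim D₁ D₂ ∧
      D₁.OnGrid (7 * (Fintype.card V : ℤ) - 10) (7 * (Fintype.card V : ℤ) - 10) ∧
      D₂.OnGrid (7 * (Fintype.card V : ℤ) - 10) (7 * (Fintype.card V : ℤ) - 10) ∧
      (∀ e, (D₁.edge e).bends ≤ 3) ∧ (∀ e, (D₂.edge e).bends ≤ 3) := by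
  classical
  have haz : a ≠ z := by
    rintro rfl
    omega
  have hzy : z ≠ y := by
    rintro rfl
    omega
  obtain ⟨x, hx⟩ := hf₂.exists_eq (show Fintype.card V - 2 < Fintype.card V by omega)
  have hxy : x ≠ y := by
    rintro rfl
    omega
  set l₁ := inDegree G₁ f₁ true with hl₁
  set r₁ := inDegree G₁ f₁ false with hr₁
  set l₂ := inDegree G₂ f₂ true with hl₂
  set r₂ := inDegree G₂ f₂ false with hr₂
  have sl₁ : ∑ v, l₁ v + 1 ≤ _ := hf₁.sum_inDegree_true_le hz
  have sr₁ : ∑ v, r₁ v + 2 ≤ _ := hf₁.sum_inDegree_false_le ha hz haz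
  have sl₂ : ∑ v, l₂ v + 1 ≤ _ := hf₂.sum_inDegree_true_le hy
  have sr₂ : ∑ v, r₂ v + 2 ≤ _ := hf₂.sum_inDegree_false_le hz' hy hzy
  have r₂x : ¬ 0 < r₂ x := hf₂.inDegree_false_of_last (by omega)
  have r₂y : ¬ 0 < r₂ y := hf₂.inDegree_false_of_last (by omega)
  have l₂z : ¬ 0 < l₂ z := IsBook.inDegree_true_of_first hz'
  have l₁a : ¬ 0 < l₁ a := IsBook.inDegree_true_of_first ha
  have r₁z : ¬ 0 < r₁ z := hf₁.inDegree_false_of_last (by omega)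
  obtain ⟨x', hx'⟩ := hf₁.exists_eq (show Fintype.card V - 2 < Fintype.card V by omega)
  have hxz : x' ≠ z := by
    rintro rfl
    omega
  have r₁x : ¬ 0 < r₁ x' := hf₁.inDegree_false_of_last (by omega)
  have b1 : ∑ v, max (l₁ v) (if 0 < r₂ v then 1 else 0) + 3 ≤ 2 * Fintype.card V := by
    have h1 := sum_max_le l₁ (fun v => 0 < r₂ v)
    have h2 := card_filter_add_two_le hxy (P := fun v => 0 < r₂ v ∧ l₁ v = 0)
      (fun h => r₂x h.1) (fun h => r₂y h.1)
    omega
  have b2 : ∑ v, max (r₁ v) (if 0 < l₂ v then 1 else 0) + 4 ≤ 2 * Fintype.card V := by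
    have h1 := sum_max_le r₁ (fun v => 0 < l₂ v)
    -- A column reserved for a slot also serves the other drawing, so a head on the lower page of
    -- the first graph saves one column.
    by_cases hv : ∃ v, 0 < r₁ v
    · obtain ⟨v, hv⟩ := hv
      have hvz : v ≠ z := by
        rintro rfl
        exact r₁z hv
      have h2 := card_filter_add_two_le hvz (P := fun v => 0 < l₂ v ∧ r₁ v = 0)
        (fun h => hv.ne' h.2) (fun h => l₂z h.1)
      omega
    · push Not at hv
      have h2 := card_filter_add_one_le (P := fun v => 0 < l₂ v ∧ r₁ v = 0) (x := z)
        (fun h => l₂z h.1)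
      have h3 : ∑ v, r₁ v = 0 := Finset.sum_eq_zero fun v _ => Nat.le_zero.1 (hv v)
      omega
  have b3 : ∑ v, max (r₂ v) (if 0 < r₁ v then 1 else 0) + 4 ≤ 2 * Fintype.card V := by
    have h1 := sum_max_le r₂ (fun v => 0 < r₁ v)
    have h2 := card_filter_add_two_le hxz (P := fun v => 0 < r₁ v ∧ r₂ v = 0)
      (fun h => r₁x h.1) (fun h => r₁z h.1)
    omega
  have b4 : ∑ v, max (l₂ v) (if 0 < l₁ v then 1 else 0) + 3 ≤ 2 * Fintype.card V := by
    have h1 := sum_max_le l₂ (fun v => 0 < l₁ v)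
    -- Either the second graph has fewer than `n - 1` edges on its upper page, or its last vertex `y`
    -- is a head there and saves one row.
    by_cases hs : Fintype.card V ≤ ∑ v, l₂ v + 1
    · have h2 := hf₂.inDegree_true_of_last hy (by omega) hs
      have h3 := card_filter_add_two_le hya (P := fun v => 0 < l₁ v ∧ l₂ v = 0)
        (fun h => h2.ne' h.2) (fun h => l₁a h.1)
      omega
    · have h3 := card_filter_add_one_le (P := fun v => 0 < l₁ v ∧ l₂ v = 0) (x := a)
        (fun h => l₁a h.1)
      omega
  refine exists_isRacSim_of_isBook hf₁ hf₂
    (w₁ := reserve (inDegree G₁ f₁) fun b v => 0 < inDegree G₂ f₂ (!b) v)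
    (w₂ := reserve (inDegree G₂ f₂) fun b v => 0 < inDegree G₁ f₁ b v)
    (fun b v => le_max_left _ _) (fun b v => le_max_left _ _)
    (fun b v h => lt_of_lt_of_le (by simp [h]) (le_max_right _ _))
    (fun b v h => lt_of_lt_of_le (by simp [h]) (le_max_right _ _)) (by omega) ?_ ?_
  · simp only [Finset.sum_add_distrib, Finset.sum_const, Finset.card_univ, smul_eq_mul, mul_one,
      reserve, Bool.not_true, Bool.not_false, ← hl₁, ← hr₁, ← hl₂, ← hr₂]
    omega
  · simp only [Finset.sum_add_distrib, Finset.sum_const, Finset.card_univ, smul_eq_mul, mul_one,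
      reserve, ← hl₁, ← hr₁, ← hl₂, ← hr₂]
    omega

end RacSim

/-! ### Two vertices -/

namespace RacSim

lemma coord_of_mem_segment {x y z : Plane} (hz : z ∈ segment ℝ x y) {α β c : ℝ}
    (hx : α * x 0 + β * x 1 = c) (hy : α * y 0 + β * y 1 = c) : α * z 0 + β * z 1 = c := by
  obtain ⟨s, t, -, -, hst, rfl⟩ := hz
  simp only [PiLp.add_apply, PiLp.smul_apply, smul_eq_mul]
  linear_combination s * hx + t * hy + c * hst

lemma plane_ext {z : Plane} {x y : ℝ} (hx : z 0 = x) (hy : z 1 = y) : z = !₂[x, y] := by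
  ext k
  fin_cases k
  · simpa using hx
  · simpa using hy

/-- For two vertices, the sides of a right-angled triangle serve as the two drawings of the edge
between them: the general construction needs too many columns in this case. -/
lemma exists_isRacSim_of_card_eq_two {V : Type*} [Fintype V] (hn : Fintype.card V = 2)
    (G₁ G₂ : SimpleGraph V) :
    ∃ (p : V → Plane) (D₁ : PolylineDrawing G₁ p) (D₂ : PolylineDrawing G₂ p),
      IsRacSim D₁ D₂ ∧ D₁.OnGrid 4 4 ∧ D₂.OnGrid 4 4 ∧
      (∀ e, (D₁.edge e).bends ≤ 3) ∧ (∀ e, (D₂.edge e).bends ≤ 3) := by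
  classical
  obtain ⟨a, b, hab, huniv⟩ := Finset.card_eq_two.1 (Finset.card_univ.trans hn)
  have hV : ∀ v, v = a ∨ v = b := fun v => by
    have := Finset.mem_univ v
    rwa [huniv, Finset.mem_insert, Finset.mem_singleton] at this
  have hE : ∀ {G : SimpleGraph V} (e : G.edgeSet), (e : Sym2 V) = s(a, b) := by
    rintro G ⟨e, he⟩
    induction e with
    | _ u v =>
      have hne : u ≠ v := G.ne_of_adj he
      rcases hV u with rfl | rfl <;> rcases hV v with rfl | rfl
      · exact absurd rfl hne
      · rfl
      · exact Sym2.eq_swap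
      · exact absurd rfl hne
  let p : V → Plane := fun v => if v = a then !₂[0, 0] else !₂[1, 0]
  have pa : p a = !₂[0, 0] := if_pos rfl
  have pb : p b = !₂[1, 0] := if_neg hab.symm
  have hends : ∀ {G : SimpleGraph V} (e : G.edgeSet),
      s((!₂[0, 0] : Plane), !₂[1, 0]) = (e : Sym2 V).map p := by
    intro G e
    rw [hE e, Sym2.map_mk, pa, pb]
  have hp : Function.Injective p := by
    intro u v h
    have h0 := congrFun (congrArg WithLp.ofLp h) 0
    rcases hV u with rfl | rfl <;> rcases hV v with rfl | rfl
    · rfl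
    · simp [pa, pb] at h0
    · simp [pa, pb] at h0
    · rfl
  let P₁ : Polyline := ⟨0, ![!₂[0, 0], !₂[1, 0]]⟩
  let P₂ : Polyline := ⟨1, ![!₂[0, 0], !₂[0, 1], !₂[1, 0]]⟩
  let D₁ : PolylineDrawing G₁ p := ⟨fun _ => P₁, hends⟩
  let D₂ : PolylineDrawing G₂ p := ⟨fun _ => P₂, hends⟩
  have hplanar : ∀ {G : SimpleGraph V} (D : PolylineDrawing G p), (∀ e, (D.edge e).IsSimple) →
      D.IsPlanar := fun D hD =>
    { injective := hp
      simple := hD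
      vertex := fun e w _ => by
        rw [hE e, Sym2.mem_iff]
        exact hV w
      disjoint := fun e f hef => absurd (Subtype.ext ((hE e).trans (hE f).symm)) hef }
  have s₁ : ∀ i, ∀ z ∈ P₁.seg i, z 1 = 0 := by
    intro (i : Fin 1) z hz
    fin_cases i
    have := coord_of_mem_segment hz (α := 0) (β := 1) (c := 0) (by simp [P₁]) (by simp [P₁])
    linarith
  have s₂ : ∀ z ∈ P₂.seg (0 : Fin 2), z 0 = 0 := by
    intro z hz
    have := coord_of_mem_segment hz (α := 1) (β := 0) (c := 0) (by simp [P₂]) (by simp [P₂])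
    linarith
  have s₃ : ∀ z ∈ P₂.seg (1 : Fin 2), z 0 + z 1 = 1 := by
    intro z hz
    have := coord_of_mem_segment hz (α := 1) (β := 1) (c := 1) (by simp [P₂]) (by simp [P₂])
    linarith
  have hsub : ∀ i j, ∃ v, ∀ z ∈ P₁.seg i ∩ P₂.seg j, z = p v := by
    intro i (j : Fin 2)
    fin_cases j
    · refine ⟨a, fun z hz => ?_⟩
      rw [pa]
      exact plane_ext (s₂ z hz.2) (s₁ i z hz.1)
    · refine ⟨b, fun z hz => ?_⟩
      have h1 := s₁ i z hz.1
      have h2 := s₃ z hz.2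
      rw [pb]
      exact plane_ext (by linarith) h1
  let S : Set Plane := {z | ∃ x y : ℤ, 0 ≤ x ∧ x < 4 ∧ 0 ≤ y ∧ y < 4 ∧ z = !₂[(x : ℝ), (y : ℝ)]}
  have k₁ : !₂[0, 0] ∈ S := ⟨0, 0, by simp⟩
  have k₂ : !₂[1, 0] ∈ S := ⟨1, 0, by simp⟩
  have k₃ : !₂[0, 1] ∈ S := ⟨0, 1, by simp⟩
  have hpS : ∀ v, p v ∈ S := by
    intro v
    rcases hV v with rfl | rfl
    · rwa [pa]
    · rwa [pb]
  refine ⟨p, D₁, D₂, ⟨hplanar D₁ fun e => ⟨?_, ?_⟩, hplanar D₂ fun e => ⟨?_, ?_⟩, ?_, ?_⟩,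
    ⟨hpS, fun e => ?_⟩, ⟨hpS, fun e => ?_⟩, fun _ => Nat.zero_le _,
    fun _ => (by norm_num : 1 ≤ 3)⟩
  · intro (i : Fin 1) h
    fin_cases i
    have h0 := congrFun (congrArg WithLp.ofLp h) 0
    simp [D₁, P₁] at h0
  · intro (i : Fin 1) (j : Fin 1) hij
    exact absurd (Subsingleton.elim i j) hij.ne
  · intro (i : Fin 2) h
    fin_cases i
    · have h0 := congrFun (congrArg WithLp.ofLp h) 1
      simp [D₂, P₂] at h0
    · have h0 := congrFun (congrArg WithLp.ofLp h) 0
      simp [D₂, P₂] at h0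
  · intro (i : Fin 2) (j : Fin 2) hij z hz
    fin_cases i <;> fin_cases j
    · exact absurd hij (lt_irrefl _)
    · have h1 := s₂ z hz.1
      have h2 := s₃ z hz.2
      exact ⟨rfl, plane_ext h1 (by linarith)⟩
    · exact absurd hij (show ¬ (1 : Fin 2) < 0 by decide)
    · exact absurd hij (lt_irrefl _)
  · intro e f i j x hx y hy
    obtain ⟨v, hv⟩ := hsub i j
    rw [hv x hx, hv y hy]
  · intro e f i j z hz hzp
    obtain ⟨v, hv⟩ := hsub i j
    exact absurd ⟨v, (hv z hz).symm⟩ hzp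
  · intro (i : Fin 2)
    fin_cases i
    · exact k₁
    · exact k₂
  · intro (i : Fin 3)
    fin_cases i
    · exact k₁
    · exact k₃
    · exact k₂

end RacSim

theorem theorem3 {V : Type*} [Fintype V] (hn : 2 ≤ Fintype.card V)
    (G₁ G₂ : SimpleGraph V)
    (h₁ : RacSim.IsOuterplanar G₁) (h₂ : RacSim.IsOuterplanar G₂) :
    ∃ (p : V → RacSim.Plane)
      (D₁ : RacSim.PolylineDrawing G₁ p) (D₂ : RacSim.PolylineDrawing G₂ p),
      RacSim.IsRacSim D₁ D₂ ∧
      D₁.OnGrid (7 * (Fintype.card V : ℤ) - 10) (7 * (Fintype.card V : ℤ) - 10) ∧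
      D₂.OnGrid (7 * (Fintype.card V : ℤ) - 10) (7 * (Fintype.card V : ℤ) - 10) ∧
      (∀ e, (D₁.edge e).bends ≤ 3) ∧
      (∀ e, (D₂.edge e).bends ≤ 3) := by
  rcases hn.eq_or_lt with hn | hn
  · rw [← hn]
    exact RacSim.exists_isRacSim_of_card_eq_two hn.symm G₁ G₂
  · obtain ⟨g₁, hg₁⟩ := h₁.exists_bookOrder
    obtain ⟨f₁, hf₁, -⟩ := hg₁.exists_isBook
    obtain ⟨a, ha⟩ := hf₁.exists_eq (show 0 < Fintype.card V by omega)
    obtain ⟨c, hc⟩ := hf₁.exists_eq (show 1 < Fintype.card V by omega)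
    obtain ⟨z, hz⟩ := hf₁.exists_eq (show Fintype.card V - 1 < Fintype.card V by omega)
    obtain ⟨g, hg⟩ := h₂.exists_bookOrder
    -- The last vertex of the first order is to be the first one of the second order, and the first
    -- vertex of the first order is not to be the last one of the second order.
    obtain ⟨g₂, hg₂, hfirst, x, hx⟩ := hg.exists_first_not_last (z := z) (a := a) (c := c)
      (by rintro rfl; omega) (by rintro rfl; omega) (by rintro rfl; omega)
    obtain ⟨f₂, hf₂, hlt⟩ := hg₂.exists_isBook
    obtain ⟨z', hz'⟩ := hf₂.exists_eq (show 0 < Fintype.card V by omega)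
    obtain ⟨y, hy⟩ := hf₂.exists_eq (show Fintype.card V - 1 < Fintype.card V by omega)
    have hzz : f₂ z = 0 := by
      by_contra hne
      have := (hlt z' z).1 (by omega)
      have := hfirst z'
      omega
    refine RacSim.exists_isRacSim_of_three_le hf₁ hf₂ hn ha (by omega) hzz (y := y) (by omega) ?_
    rintro rfl
    have := (hlt y x).2 hx
    have := hf₂.lt_card x
    omega
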